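/- Let $\mathcal H$ be the one-particle Hilbert space of Einstein–Rosen waves: through the mode decomposition $C(r)=\frac1{\sqrt2}\int_0^\infty c(w)J_0(wr)\,\mathrm dw$ its elements $C$ are identified with their mode functions $c\in L^2((0,\infty),\mathrm dw)$, with $\langle C_1,C_2\rangle=\int_0^\infty\overline{c_1(w)}c_2(w)\,\mathrm dw$, and $\sqrt\Theta=\sqrt{-\Delta}$ acts as multiplication by $w$. Let $H_0=\mathrm d\Gamma(\sqrt\Theta)$ be the free Hamiltonian on the symmetric Fock space over $\mathcal H$ (so that $H_0$ is multiplication by $w_1+\dots+w_n$ on $n$-particle states), let $E(x)=2-2e^{-x/2}$, and let $H=E(H_0)$ be the full Hamiltonian. For $N\in\mathbb N$, $t\in\mathbb R$ let $$D_C(t,N)=2-2e^{-\|C\|^2}\sum_{n=0}^{N}\frac1{n!}\bigl\langle C^{\otimes n}\,\big|\,\cos\bigl(t(E(H_0)-H_0)\bigr)C^{\otimes n}\bigr\rangle ,$$ the truncation of the squared distance $\|e^{-itH_0}\Phi_C-e^{-itH}\Phi_C\|^2$ between the free and the full evolution of the coherent state $\Phi_C=e^{-\|C\|^2/2}\bigoplus_{n\ge0}\frac1{\sqrt{n!}}C^{\otimes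 n}$. Let $C\in\mathcal H$ have a mode function with $$|c(w)|^2=B_cw^{\beta_c}+O(w^{\beta_c+2})\qquad(w\to0^+),$$ where $B_c\neq0$ and $\beta_c\ge2$ are real constants. Assume that $c$ is regular in the following sense: $|c|^2$ is $C^\infty$ on $(0,\infty)$; its derivatives of all orders $k\ge1$ are integrable on $(1,\infty)$; and the above expansion may be differentiated term by term, i.e. $\frac{\mathrm d^k}{\mathrm dw^k}\bigl(|c(w)|^2-B_cw^{\beta_c}\bigr)=O(w^{\beta_c+2-k})$ as $w\to0^+$ for all $k\ge1$. (If $c(w)/w$, with $w=\sqrt{w_1^2+w_2^2}$, is a smooth function of rapid decay of $(w_1,w_2)\in\mathbb R^2$, this regularity follows from the expansion of $|c|^2$.) Then for every $N\ge1$, as $t\to\infty$, $$D_C(t,N)=2-2e^{-\|C\|^2}-B_ce^{-\|C\|^2}\,\Gamma\!\left(\frac{\beta_c+1}2\right)\cos\!\left(\frac{\pi}{4}(\beta_c+1)\right)\left(\frac4t\right)^{\frac{\beta_c+1}2}+o\!\left(t^{-\frac{\beta_c+1}2}\right).$$ In particular $D_C(t,N)-(2-2e^{-\|C\|^2})=O(t^{-3/2})$,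 i.e. $D_C(t,N)$ approaches $2-2e^{-\|C\|^2}$ at rate $t^{-3/2}$ or faster. -/

import Mathlib

open MeasureTheory Filter Topology Asymptotics Set
open scoped ContDiff

noncomputable section

namespace EinsteinRosen

/-- Lebesgue measure `dw` on the half-line of modes `w > 0`. -/
def modeMeasure : Measure ℝ := volume.restrict (Ioi 0)

instance : SigmaFinite modeMeasure := by unfold modeMeasure; infer_instance

/-- Lebesgue measure `dw₁ ⋯ dwₙ` on `(0, ∞)ⁿ`. -/
def modesMeasure (n : ℕ) : Measure (Fin n → ℝ) := Measure.pi fun _ => modeMeasure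

/-- The one-particle Hilbert space, in the mode representation
`C(r) = (1/√2) ∫₀^∞ c(w) J₀(w r) dw`: its scalar product is `∫₀^∞ conj (c₁ w) * c₂ w dw`, and
`√Θ` is multiplication by `w`. -/
abbrev OneParticle : Type := Lp ℂ 2 modeMeasure

/-- The Hilbert tensor product of `n` copies of the one-particle space, realised as
`L²((0, ∞)ⁿ)`; its symmetric functions form the `n`-particle sector of the Fock space. -/
abbrev NParticle (n : ℕ) : Type := Lp ℂ 2 (modesMeasure n)

theorem memLp_tensor {c : ℝ → ℂ} (hc : MemLp c 2 modeMeasure) (n : ℕ) :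
    MemLp (fun w : Fin n → ℝ => ∏ j, c (w j)) 2 (modesMeasure n) := by
  have hm : AEStronglyMeasurable (fun w : Fin n → ℝ => ∏ j, c (w j)) (modesMeasure n) := by
    refine Finset.aestronglyMeasurable_fun_prod _ fun j _ => ?_
    exact hc.aestronglyMeasurable.comp_quasiMeasurePreserving
      (Measure.quasiMeasurePreserving_eval (fun _ : Fin n => modeMeasure) j)
  rw [memLp_two_iff_integrable_sq_norm hm]
  have h2 : Integrable (fun w => ‖c w‖ ^ 2) modeMeasure :=
    (memLp_two_iff_integrable_sq_norm hc.aestronglyMeasurable).1 hc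
  have h3 : Integrable (fun w : Fin n → ℝ => ∏ j, ‖c (w j)‖ ^ 2) (modesMeasure n) :=
    Integrable.fintype_prod (f := fun _ : Fin n => fun w => ‖c w‖ ^ 2) fun _ => h2
  simpa only [norm_prod, Finset.prod_pow] using h3

/-- The tensor power `C ⊗ ⋯ ⊗ C` (`n` factors), the function `c(w₁) ⋯ c(wₙ)`. -/
def tensorPower (n : ℕ) (C : OneParticle) : NParticle n :=
  (memLp_tensor (Lp.memLp C) n).toLp _

/-- The functional calculus `f ↦ f(H₀)` of the free Hamiltonian `H₀ = dΓ(√Θ)` on `n` particles.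
There `H₀ = ∑ⱼ 1 ⊗ ⋯ ⊗ √Θ ⊗ ⋯ ⊗ 1` is multiplication by `w₁ + ⋯ + wₙ`, so `f(H₀)` is multiplication
by `f (w₁ + ⋯ + wₙ)` on its maximal domain; `f = id` gives `H₀` itself. -/
def freeHamiltonianCalculus (n : ℕ) (f : ℝ → ℂ) : NParticle n →ₗ.[ℂ] NParticle n where
  domain :=
    { carrier := {ψ | MemLp (fun w => f (∑ j, w j) * ψ w) 2 (modesMeasure n)}
      add_mem' := by
        intro a b ha hb
        refine (memLp_congr_ae ?_).1 (MemLp.add ha hb)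
        filter_upwards [Lp.coeFn_add a b] with w hw
        simp only [Pi.add_apply, hw, mul_add]
      zero_mem' := by
        refine (memLp_congr_ae ?_).1 (MemLp.zero' (ε := ℂ))
        filter_upwards [Lp.coeFn_zero ℂ 2 (modesMeasure n)] with w hw
        simp only [hw, Pi.zero_apply, mul_zero]
      smul_mem' := by
        intro z a ha
        refine (memLp_congr_ae ?_).1 (MemLp.const_smul ha z)
        filter_upwards [Lp.coeFn_smul z a] with w hw
        simp [hw, mul_left_comm] }
  toFun :=
    { toFun := fun ψ => MemLp.toLp (fun w => f (∑ j, w j) * (ψ : NParticle n) w) ψ.2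
      map_add' := by
        intro a b
        rw [← MemLp.toLp_add]
        refine MemLp.toLp_congr _ _ ?_
        filter_upwards [Lp.coeFn_add (a : NParticle n) b] with w hw
        simp only [Pi.add_apply, hw, mul_add, Submodule.coe_add]
      map_smul' := by
        intro z a
        rw [RingHom.id_apply, ← MemLp.toLp_const_smul]
        refine MemLp.toLp_congr _ _ ?_
        filter_upwards [Lp.coeFn_smul z (a : NParticle n)] with w hw
        simp [hw, mul_left_comm] }

/-- The energy function `E(x) = 2 - 2 exp(-x/2)`; the full Hamiltonian is `H = E(H₀)`. -/
def energy (x : ℝ) : ℝ := 2 - 2 * Real.exp (-x / 2)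

theorem mem_domain_cos (n : ℕ) (t : ℝ) (ψ : NParticle n) :
    ψ ∈ (freeHamiltonianCalculus n
      (fun x => (Real.cos (t * (energy x - x)) : ℂ))).domain := by
  change MemLp (fun w : Fin n → ℝ =>
    (Real.cos (t * (energy (∑ j, w j) - ∑ j, w j)) : ℂ) * ψ w) 2 (modesMeasure n)
  have hcont : Continuous fun w : Fin n → ℝ =>
      (Real.cos (t * (energy (∑ j, w j) - ∑ j, w j)) : ℂ) := by
    unfold energy
    fun_prop
  refine MemLp.mono (Lp.memLp ψ) (hcont.aestronglyMeasurable.mul (Lp.aestronglyMeasurable ψ)) ?_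
  refine Eventually.of_forall fun w => ?_
  rw [norm_mul, Complex.norm_real, Real.norm_eq_abs]
  exact mul_le_of_le_one_left (norm_nonneg _) (Real.abs_cos_le_one _)

/-- The bounded operator `cos (t (E(H₀) - H₀))` on the `n`-particle space. -/
def cosEvolution (n : ℕ) (t : ℝ) (ψ : NParticle n) : NParticle n :=
  freeHamiltonianCalculus n (fun x => (Real.cos (t * (energy x - x)) : ℂ))
    ⟨ψ, mem_domain_cos n t ψ⟩

/-- The truncation
`D_C(t, N) = 2 - 2 e^{-‖C‖²} ∑_{n=0}^{N} (1/n!) ⟨C^{⊗n} | cos(t (E(H₀) - H₀)) C^{⊗n}⟩`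
of the squared distance `‖exp(-itH₀) Φ_C - exp(-itH) Φ_C‖²` between the free and the full
evolution of the coherent state `Φ_C`. The scalar products are real. -/
def truncatedSqDist (C : OneParticle) (t : ℝ) (N : ℕ) : ℝ :=
  2 - 2 * Real.exp (-‖C‖ ^ 2) * ∑ n ∈ Finset.range (N + 1),
    (1 / (n.factorial : ℝ)) *
      (inner ℂ (tensorPower n C) (cosEvolution n t (tensorPower n C))).re

end EinsteinRosen

end

/-! On `n` particles the matrix element is the real part of the integral of `∏ⱼ |c(wⱼ)|² ·
exp(-itφ(w₁+⋯+wₙ))`, with phase `φ(x) = x - E(x) = x²/4 + O(x³)`, whose only stationary point on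
`[0, ∞)` is the endpoint `0`. The vacuum term is the constant `1`, and the asymptotics come from the
one-particle term: the scale `w ~ t^(-1/2)` combined with `|c|² ~ B w^β` gives the size
`t^(-(β+1)/2)`.

The leading coefficient is found by comparison. `modelDensity` behaves like `w^β` at `0` and is
built so that the substitution `x = φ(w)` turns its oscillatory integral into Euler's integral with
rate `1 + it`, equal to a multiple of `Γ((β+1)/2) (1+it)^(-(β+1)/2)`
(`integral_modelDensity_mul_osc`). The difference `|c|² - B · modelDensity` vanishes to one order
more at `0`, with all its derivatives, and integration by parts plus a cut at `w = t^(-1/2)` shows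
that it contributes a lower order (`EndpointRegular.exists_norm_integral_le`).

For `n ≥ 2`, integrate over one mode and freeze the sum `y > 0` of the others. The shifted phase
`φ(w+y)` is not stationary, so `K < β+1` integrations by parts give `t^(-K) min(y,1)^(-K)`
(`EndpointRegular.exists_norm_integral_shift_le`), and this singularity in `y` is integrable against
the remaining densities. Since `β > 1`, some integer `K` lies strictly between `(β+1)/2` and `β+1`,
so these terms are negligible. -/

namespace EinsteinRosen

/-! ### Symbol calculus on the half-line: order at the origin, exponential rate at infinity. -/

/-- The weight `min(w, 1) ^ α * exp (γ w)` on the half-line. -/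
noncomputable def symbolWeight (α γ w : ℝ) : ℝ := min w 1 ^ α * Real.exp (γ * w)

theorem symbolWeight_pos {α γ w : ℝ} (hw : 0 < w) : 0 < symbolWeight α γ w :=
  mul_pos (Real.rpow_pos_of_pos (lt_min hw one_pos) _) (Real.exp_pos _)

theorem symbolWeight_mul {α γ α' γ' w : ℝ} (hw : 0 < w) :
    symbolWeight α γ w * symbolWeight α' γ' w = symbolWeight (α + α') (γ + γ') w := by
  unfold symbolWeight
  rw [Real.rpow_add (lt_min hw one_pos), add_mul, Real.exp_add]
  ring

theorem symbolWeight_mono {α γ α' γ' w : ℝ} (hα : α' ≤ α) (hγ : γ ≤ γ') (hw : 0 < w) :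
    symbolWeight α γ w ≤ symbolWeight α' γ' w := by
  unfold symbolWeight
  have h1 : min w 1 ^ α ≤ min w 1 ^ α' :=
    Real.rpow_le_rpow_of_exponent_ge (lt_min hw one_pos) (min_le_right _ _) hα
  have h2 : Real.exp (γ * w) ≤ Real.exp (γ' * w) :=
    Real.exp_le_exp.2 (mul_le_mul_of_nonneg_right hγ hw.le)
  exact mul_le_mul h1 h2 (Real.exp_pos _).le (Real.rpow_nonneg (lt_min hw one_pos).le _)

theorem symbolWeight_of_le_one {α γ w : ℝ} (hw : w ≤ 1) :
    symbolWeight α γ w = w ^ α * Real.exp (γ * w) := by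
  rw [symbolWeight, min_eq_left hw]

theorem symbolWeight_of_one_le {α γ w : ℝ} (hw : 1 ≤ w) :
    symbolWeight α γ w = Real.exp (γ * w) := by
  rw [symbolWeight, min_eq_right hw, Real.one_rpow, one_mul]

/-- `f` is bounded on the half-line by a multiple of the weight. -/
def SymbolBound (α γ : ℝ) (f : ℝ → ℝ) : Prop :=
  ∃ C, ∀ w, 0 < w → |f w| ≤ C * symbolWeight α γ w

theorem SymbolBound.exists_pos {α γ : ℝ} {f : ℝ → ℝ} (h : SymbolBound α γ f) :
    ∃ C, 0 < C ∧ ∀ w, 0 < w → |f w| ≤ C * symbolWeight α γ w := by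
  obtain ⟨C, hC⟩ := h
  refine ⟨|C| + 1, by positivity, fun w hw => (hC w hw).trans ?_⟩
  exact mul_le_mul_of_nonneg_right (by linarith [le_abs_self C]) (symbolWeight_pos hw).le

theorem SymbolBound.mono {α γ α' γ' : ℝ} {f : ℝ → ℝ} (h : SymbolBound α γ f)
    (hα : α' ≤ α) (hγ : γ ≤ γ') : SymbolBound α' γ' f := by
  obtain ⟨C, h0, hC⟩ := h.exists_pos
  exact ⟨C, fun w hw => (hC w hw).trans
    (mul_le_mul_of_nonneg_left (symbolWeight_mono hα hγ hw) h0.le)⟩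

theorem SymbolBound.add {α γ : ℝ} {f g : ℝ → ℝ} (hf : SymbolBound α γ f)
    (hg : SymbolBound α γ g) : SymbolBound α γ (fun w => f w + g w) := by
  obtain ⟨C, hC⟩ := hf
  obtain ⟨D, hD⟩ := hg
  refine ⟨C + D, fun w hw => (abs_add_le _ _).trans ?_⟩
  rw [add_mul]
  exact add_le_add (hC w hw) (hD w hw)

theorem SymbolBound.mul {α γ α' γ' : ℝ} {f g : ℝ → ℝ} (hf : SymbolBound α γ f)
    (hg : SymbolBound α' γ' g) : SymbolBound (α + α') (γ + γ') (fun w => f w * g w) := by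
  obtain ⟨C, h0, hC⟩ := hf.exists_pos
  obtain ⟨D, h1, hD⟩ := hg.exists_pos
  refine ⟨C * D, fun w hw => ?_⟩
  rw [abs_mul, ← symbolWeight_mul hw, mul_mul_mul_comm]
  exact mul_le_mul (hC w hw) (hD w hw) (abs_nonneg _) (mul_pos h0 (symbolWeight_pos hw)).le

theorem SymbolBound.congr {α γ : ℝ} {f g : ℝ → ℝ} (hf : SymbolBound α γ f)
    (h : ∀ w, 0 < w → g w = f w) : SymbolBound α γ g := by
  obtain ⟨C, hC⟩ := hf
  exact ⟨C, fun w hw => by rw [h w hw]; exact hC w hw⟩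

theorem symbolBound_of_split {α γ : ℝ} {f : ℝ → ℝ} (C D : ℝ)
    (h0 : ∀ w, 0 < w → w ≤ 1 → |f w| ≤ C * w ^ α)
    (h1 : ∀ w, 1 ≤ w → |f w| ≤ D * Real.exp (γ * w)) : SymbolBound α γ f := by
  have hD : 0 ≤ D := by
    by_contra! hneg
    have := (abs_nonneg _).trans (h1 1 le_rfl)
    nlinarith [Real.exp_pos (γ * 1)]
  have hC : 0 ≤ C := by
    by_contra! hneg
    have := (abs_nonneg _).trans (h0 1 one_pos le_rfl)
    rw [Real.one_rpow] at this
    linarith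
  -- On `(0, 1]` the factor `exp (γ w)` may be as small as `exp (-|γ|)`; the factor `exp |γ|`
  -- compensates for it.
  refine ⟨C * Real.exp |γ| + D, fun w hw => ?_⟩
  rcases le_total w 1 with h | h
  · refine (h0 w hw h).trans ?_
    rw [symbolWeight_of_le_one h]
    have hwα : 0 ≤ w ^ α := Real.rpow_nonneg hw.le _
    have he : 1 ≤ Real.exp |γ| * Real.exp (γ * w) := by
      rw [← Real.exp_add]
      refine Real.one_le_exp ?_
      have : -|γ| ≤ γ * w := by
        rcases abs_cases γ with ⟨h', h''⟩ | ⟨h', h''⟩ <;> rw [h'] <;> nlinarith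
      linarith
    have h3 : C * w ^ α ≤ (C * w ^ α) * (Real.exp |γ| * Real.exp (γ * w)) :=
      le_mul_of_one_le_right (by positivity) he
    have h4 : 0 ≤ D * (w ^ α * Real.exp (γ * w)) := by positivity
    linarith
  · refine (h1 w h).trans ?_
    rw [symbolWeight_of_one_le h]
    exact mul_le_mul_of_nonneg_right (by have := Real.exp_pos |γ|; nlinarith) (Real.exp_pos _).le

/-- `f` has `K` derivatives on the half-line, the `j`-th one being bounded by a multiple of
`min(w, 1) ^ (α - j) * exp (γ w)`. -/
def IsSymbol : ℕ → ℝ → ℝ → (ℝ → ℝ) → Prop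
  | 0, α, γ, f => SymbolBound α γ f ∧ ContinuousOn f (Ioi 0)
  | K + 1, α, γ, f => SymbolBound α γ f ∧ ∃ f', (∀ w, 0 < w → HasDerivAt f (f' w) w) ∧
      IsSymbol K (α - 1) γ f'

theorem IsSymbol.bound : ∀ {K : ℕ} {α γ : ℝ} {f : ℝ → ℝ}, IsSymbol K α γ f → SymbolBound α γ f
  | 0, _, _, _, h => h.1
  | _ + 1, _, _, _, h => h.1

theorem IsSymbol.continuousOn :
    ∀ {K : ℕ} {α γ : ℝ} {f : ℝ → ℝ}, IsSymbol K α γ f → ContinuousOn f (Ioi 0)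
  | 0, _, _, _, h => h.2
  | _ + 1, _, _, _, h => fun w hw => by
      obtain ⟨f', hf', -⟩ := h.2
      exact (hf' w hw).continuousAt.continuousWithinAt

theorem IsSymbol.pred : ∀ {K : ℕ} {α γ : ℝ} {f : ℝ → ℝ}, IsSymbol (K + 1) α γ f → IsSymbol K α γ f
  | 0, _, _, _, h => ⟨h.bound, h.continuousOn⟩
  | K + 1, _, _, _, h => by
      obtain ⟨hb, f', hf', hs⟩ := h
      exact ⟨hb, f', hf', IsSymbol.pred hs⟩

theorem IsSymbol.congr : ∀ {K : ℕ} {α γ : ℝ} {f g : ℝ → ℝ}, IsSymbol K α γ f →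
    (∀ w, 0 < w → g w = f w) → IsSymbol K α γ g
  | 0, _, _, _, _, h, e => ⟨h.1.congr e, h.2.congr fun w hw => e w hw⟩
  | K + 1, _, _, _, _, h, e => by
      obtain ⟨hb, f', hf', hs⟩ := h
      refine ⟨hb.congr e, f', fun w hw => (hf' w hw).congr_of_eventuallyEq ?_, hs⟩
      filter_upwards [Ioi_mem_nhds hw] with x hx using e x hx

theorem IsSymbol.mono : ∀ {K : ℕ} {α γ α' γ' : ℝ} {f : ℝ → ℝ}, IsSymbol K α γ f →
    α' ≤ α → γ ≤ γ' → IsSymbol K α' γ' f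
  | 0, _, _, _, _, _, h, ha, hg => ⟨h.1.mono ha hg, h.2⟩
  | K + 1, _, _, _, _, _, h, ha, hg => by
      obtain ⟨hb, f', hf', hs⟩ := h
      exact ⟨hb.mono ha hg, f', hf', hs.mono (by linarith) hg⟩

theorem IsSymbol.add : ∀ {K : ℕ} {α γ : ℝ} {f g : ℝ → ℝ}, IsSymbol K α γ f →
    IsSymbol K α γ g → IsSymbol K α γ (fun w => f w + g w)
  | 0, _, _, _, _, h, e => ⟨h.1.add e.1, h.2.add e.2⟩
  | K + 1, _, _, _, _, h, e => by
      obtain ⟨hb, f', hf', hs⟩ := h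
      obtain ⟨hb2, g', hg', hs2⟩ := e
      exact ⟨hb.add hb2, _, fun w hw => (hf' w hw).add (hg' w hw), hs.add hs2⟩

/-- Leibniz rule: each term keeps one factor undifferentiated, and `IsSymbol.pred` lowers its number
of derivatives to match the other. -/
theorem IsSymbol.mul : ∀ {K : ℕ} {α γ α' γ' : ℝ} {f g : ℝ → ℝ}, IsSymbol K α γ f →
    IsSymbol K α' γ' g → IsSymbol K (α + α') (γ + γ') (fun w => f w * g w)
  | 0, _, _, _, _, _, _, h, e => ⟨h.1.mul e.1, h.2.mul e.2⟩
  | K + 1, _, _, _, _, _, _, h, e => by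
      have h0 := h.pred
      have e0 := e.pred
      obtain ⟨hb, f', hf', hs⟩ := h
      obtain ⟨hb2, g', hg', hs2⟩ := e
      refine ⟨hb.mul hb2, _, fun w hw => (hf' w hw).mul (hg' w hw), ?_⟩
      exact ((hs.mul e0).mono (by linarith) le_rfl).add ((h0.mul hs2).mono (by linarith) le_rfl)

theorem isSymbol_zero (K : ℕ) (α γ : ℝ) : IsSymbol K α γ (fun _ => 0) := by
  induction K generalizing α with
  | zero => exact ⟨⟨0, fun w _ => by simp⟩, continuousOn_const⟩
  | succ K ih => exact ⟨⟨0, fun w _ => by simp⟩, _, fun w _ => hasDerivAt_const w 0, ih _⟩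

theorem isSymbol_const (K : ℕ) (a : ℝ) : IsSymbol K 0 0 (fun _ => a) := by
  have hb : SymbolBound 0 0 (fun _ => a) := ⟨|a|, fun w _ => by simp [symbolWeight]⟩
  cases K with
  | zero => exact ⟨hb, continuousOn_const⟩
  | succ K => exact ⟨hb, _, fun w _ => hasDerivAt_const w a, isSymbol_zero _ _ _⟩

theorem IsSymbol.const_mul {K : ℕ} {α γ : ℝ} {f : ℝ → ℝ} (h : IsSymbol K α γ f) (a : ℝ) :
    IsSymbol K α γ (fun w => a * f w) := by
  simpa using (isSymbol_const K a).mul h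

theorem exists_rpow_le_mul_exp (p : ℝ) {δ : ℝ} (hδ : 0 < δ) :
    ∃ C, 0 < C ∧ ∀ w, 1 ≤ w → w ^ p ≤ C * Real.exp (δ * w) := by
  have h := (isLittleO_rpow_exp_pos_mul_atTop p hδ).isBigO
  obtain ⟨C, hC0, hC⟩ := h.exists_pos
  obtain ⟨R, hR⟩ := eventually_atTop.1 hC.bound
  refine ⟨C + max R 1 ^ |p|, by positivity, fun w hw => ?_⟩
  have h1 : 0 < w := by linarith
  have he := Real.exp_pos (δ * w)
  rcases le_total R w with h | h
  · have := hR w h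
    rw [Real.norm_of_nonneg (Real.rpow_nonneg h1.le _), Real.norm_of_nonneg he.le] at this
    refine this.trans (mul_le_mul_of_nonneg_right ?_ he.le)
    have : 0 ≤ max R 1 ^ |p| := by positivity
    linarith
  · have h2 : w ^ p ≤ max R 1 ^ |p| :=
      (Real.rpow_le_rpow_of_exponent_le hw (le_abs_self p)).trans
        (Real.rpow_le_rpow h1.le (h.trans (le_max_left _ _)) (abs_nonneg _))
    have h3 : 1 ≤ Real.exp (δ * w) := Real.one_le_exp (by positivity)
    have : 0 ≤ max R 1 ^ |p| := by positivity
    nlinarith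

/-- The rate `1` is an arbitrary positive number absorbing polynomial growth; only the order at the
origin is used later. -/
theorem isSymbol_rpow (K : ℕ) (p : ℝ) : IsSymbol K p 1 (fun w => w ^ p) := by
  have hb : ∀ p : ℝ, SymbolBound p 1 (fun w => w ^ p) := fun p => by
    obtain ⟨C, -, hC⟩ := exists_rpow_le_mul_exp p one_pos
    refine symbolBound_of_split 1 C (fun w hw _ => ?_) (fun w hw => ?_)
    · rw [abs_of_nonneg (Real.rpow_nonneg hw.le _), one_mul]
    · rw [abs_of_nonneg (Real.rpow_nonneg (by linarith) _)]
      exact hC w hw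
  induction K generalizing p with
  | zero =>
    exact ⟨hb p, fun w hw =>
      (Real.continuousAt_rpow_const w p (Or.inl (ne_of_gt hw))).continuousWithinAt⟩
  | succ K ih =>
    exact ⟨hb p, _, fun w hw => Real.hasDerivAt_rpow_const (Or.inl hw.ne'),
      (ih (p - 1)).const_mul p⟩

theorem hasDerivAt_exp_neg_half (x : ℝ) :
    HasDerivAt (fun x => Real.exp (-x / 2)) (-(1 / 2) * Real.exp (-x / 2)) x := by
  convert! ((hasDerivAt_neg' x).div_const 2).exp using 1
  ring

theorem isSymbol_exp_neg_half (K : ℕ) : IsSymbol K 0 0 (fun w => Real.exp (-w / 2)) := by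
  have hb : SymbolBound 0 0 (fun w => Real.exp (-w / 2)) := ⟨1, fun w hw => by
    simp only [symbolWeight, Real.rpow_zero, zero_mul, Real.exp_zero, mul_one, Real.abs_exp]
    exact Real.exp_le_one_iff.2 (by linarith)⟩
  induction K with
  | zero => exact ⟨hb, by fun_prop⟩
  | succ K ih =>
    exact ⟨hb, _, fun w _ => hasDerivAt_exp_neg_half w,
      (ih.const_mul _).mono (by norm_num) le_rfl⟩

/-- Powers of a positive function with bounds on all its powers and symbol bounds on its
derivative. -/
theorem isSymbol_rpow_comp {f f' : ℝ → ℝ} {a γ : ℝ} (hpos : ∀ w, 0 < w → 0 < f w)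
    (hf : ∀ w, 0 < w → HasDerivAt f (f' w) w) (hf' : ∀ K, IsSymbol K (a - 1) 0 f')
    (hb : ∀ p : ℝ, SymbolBound (p * a) γ (fun w => f w ^ p)) (K : ℕ) (p : ℝ) :
    IsSymbol K (p * a) γ (fun w => f w ^ p) := by
  induction K generalizing p with
  | zero =>
    exact ⟨hb p, fun w hw => ((hf w hw).continuousAt.rpow_const
      (Or.inl (hpos w hw).ne')).continuousWithinAt⟩
  | succ K ih =>
    refine ⟨hb p, _, fun w hw => (hf w hw).rpow_const (Or.inl (hpos w hw).ne'), ?_⟩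
    -- The derivative is `p f' f^(p-1)`, of order `(a - 1) + (p - 1) a = p a - 1`. The induction
    -- runs over all `p` at once, so bounds on the powers themselves suffice.
    refine ((((hf' K).mul (ih (p - 1))).const_mul p).mono (α' := p * a - 1) (γ' := γ)
      (by ring_nf; rfl) (by simp)).congr fun w _ => by ring

/-- The derivatives in `IsSymbol` are only known on the half-line; being equal to the true ones on a
neighbourhood of each point there, they have the same iterated derivatives. -/
theorem IsSymbol.iteratedDeriv_bound : ∀ {K : ℕ} {α γ : ℝ} {f : ℝ → ℝ}, IsSymbol K α γ f →
    SymbolBound (α - K) γ (iteratedDeriv K f)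
  | 0, _, _, _, h => by simpa using h.1
  | K + 1, _, _, f, h => by
      obtain ⟨-, f', hf', hs⟩ := h
      have := hs.iteratedDeriv_bound
      rw [Nat.cast_succ, add_comm, ← sub_sub]
      refine this.congr fun w hw => ?_
      rw [iteratedDeriv_succ']
      refine Filter.EventuallyEq.iteratedDeriv_eq K ?_
      filter_upwards [Ioi_mem_nhds hw] with x hx using (hf' x hx).deriv

/-! ### The phase and its powers as symbols. -/

/-- The phase `x - E(x)`. -/
noncomputable def phase (x : ℝ) : ℝ := x + 2 * Real.exp (-x / 2) - 2

/-- The derivative of the phase. -/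
noncomputable def phaseDeriv (x : ℝ) : ℝ := 1 - Real.exp (-x / 2)

theorem hasDerivAt_phase (x : ℝ) : HasDerivAt phase (phaseDeriv x) x := by
  convert! ((hasDerivAt_id x).add ((hasDerivAt_exp_neg_half x).const_mul 2)).sub_const 2 using 1
  unfold phaseDeriv
  ring

theorem hasDerivAt_phaseDeriv (x : ℝ) :
    HasDerivAt phaseDeriv (1 / 2 * Real.exp (-x / 2)) x := by
  convert! (hasDerivAt_exp_neg_half x).const_sub 1 using 1
  ring

theorem continuous_phase : Continuous phase := by unfold phase; fun_prop

theorem continuous_phaseDeriv : Continuous phaseDeriv := by unfold phaseDeriv; fun_prop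

theorem phase_zero : phase 0 = 0 := by simp [phase]

theorem phaseDeriv_zero : phaseDeriv 0 = 0 := by simp [phaseDeriv]

theorem phaseDeriv_le_one (x : ℝ) : phaseDeriv x ≤ 1 := by
  unfold phaseDeriv; linarith [Real.exp_pos (-x / 2)]

theorem phaseDeriv_strictMono : StrictMono phaseDeriv := fun x y h => by
  unfold phaseDeriv
  have : Real.exp (-y / 2) < Real.exp (-x / 2) := Real.exp_lt_exp.2 (by linarith)
  linarith

theorem phaseDeriv_pos {x : ℝ} (hx : 0 < x) : 0 < phaseDeriv x := by
  rw [← phaseDeriv_zero]; exact phaseDeriv_strictMono hx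

theorem phaseDeriv_le {x : ℝ} : phaseDeriv x ≤ x / 2 := by
  unfold phaseDeriv; linarith [Real.add_one_le_exp (-x / 2)]

/-- Taylor's formula with the remainder of `Real.exp_bound`. Here and in the next lemma the
constants are small enough to give `x/4 ≤ phaseDeriv x` and `x²/6 ≤ phase x ≤ x²/3` on `(0, 1]`. -/
theorem abs_phaseDeriv_sub_le {x : ℝ} (h0 : 0 < x) (h1 : x ≤ 1) :
    |phaseDeriv x - x / 2| ≤ 3 / 16 * x ^ 2 := by
  have h := Real.exp_bound (x := -x / 2) (n := 2)
    (by rw [abs_le]; constructor <;> linarith) (by norm_num)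
  norm_num [Finset.sum_range_succ, Nat.factorial] at h
  unfold phaseDeriv
  rw [show 1 - Real.exp (-x / 2) - x / 2 = -(Real.exp (-x / 2) - (1 + -x / 2)) by ring, abs_neg]
  exact h.trans (le_of_eq (by ring))

theorem abs_phase_sub_le {x : ℝ} (h0 : 0 < x) (h1 : x ≤ 1) :
    |phase x - x ^ 2 / 4| ≤ x ^ 3 / 18 := by
  have h := Real.exp_bound (x := -x / 2) (n := 3)
    (by rw [abs_le]; constructor <;> linarith) (by norm_num)
  norm_num [Finset.sum_range_succ, Nat.factorial] at h
  have e : |x| = x := abs_of_pos h0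
  rw [abs_div, abs_neg, e] at h
  unfold phase
  rw [show x + 2 * Real.exp (-x / 2) - 2 - x ^ 2 / 4
    = 2 * (Real.exp (-x / 2) - (1 + -x / 2 + (-x / 2) ^ 2 / 2)) by ring, abs_mul]
  norm_num
  norm_num at h
  nlinarith

theorem phaseDeriv_ge_of_le_one {x : ℝ} (h0 : 0 < x) (h1 : x ≤ 1) : x / 4 ≤ phaseDeriv x := by
  have := (abs_le.1 (abs_phaseDeriv_sub_le h0 h1)).1
  nlinarith

theorem phaseDeriv_ge_of_one_le {x : ℝ} (h1 : 1 ≤ x) : 1 / 4 ≤ phaseDeriv x :=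
  (phaseDeriv_ge_of_le_one one_pos le_rfl).trans (phaseDeriv_strictMono.monotone h1)

theorem phase_strictMonoOn : StrictMonoOn phase (Ici 0) := by
  refine strictMonoOn_of_deriv_pos (convex_Ici 0) continuous_phase.continuousOn fun x hx => ?_
  rw [interior_Ici] at hx
  rw [(hasDerivAt_phase x).deriv]
  exact phaseDeriv_pos hx

theorem phase_pos {x : ℝ} (hx : 0 < x) : 0 < phase x := by
  rw [← phase_zero]; exact phase_strictMonoOn self_mem_Ici hx.le hx

theorem phase_le_self {x : ℝ} (hx : 0 < x) : phase x ≤ x := by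
  have : Real.exp (-x / 2) ≤ 1 := Real.exp_le_one_iff.2 (by linarith)
  unfold phase; linarith

theorem phase_ge_of_le_one {x : ℝ} (h0 : 0 < x) (h1 : x ≤ 1) : x ^ 2 / 6 ≤ phase x := by
  have := (abs_le.1 (abs_phase_sub_le h0 h1)).1
  nlinarith

theorem phase_le_of_le_one {x : ℝ} (h0 : 0 < x) (h1 : x ≤ 1) : phase x ≤ x ^ 2 / 3 := by
  have := (abs_le.1 (abs_phase_sub_le h0 h1)).2
  nlinarith

theorem phase_ge_of_one_le {x : ℝ} (h1 : 1 ≤ x) : 1 / 6 ≤ phase x := by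
  have := phase_ge_of_le_one one_pos le_rfl
  have h2 := phase_strictMonoOn.monotoneOn (mem_Ici.2 zero_le_one) (mem_Ici.2 (by linarith)) h1
  linarith

theorem tendsto_phase : Tendsto phase atTop atTop := by
  refine tendsto_atTop_mono (f := fun x => x - 2) (fun x => ?_)
    (tendsto_atTop_add_const_right _ _ tendsto_id)
  unfold phase
  linarith [Real.exp_pos (-x / 2)]

theorem isSymbol_phaseDeriv (K : ℕ) : IsSymbol K 1 0 phaseDeriv := by
  have hb : SymbolBound 1 0 phaseDeriv := by
    refine symbolBound_of_split 1 1 (fun w h0 h1 => ?_) (fun w h1 => ?_)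
    · rw [abs_of_pos (phaseDeriv_pos h0), Real.rpow_one]
      linarith [phaseDeriv_le (x := w)]
    · rw [abs_of_pos (phaseDeriv_pos (by linarith))]
      simpa using phaseDeriv_le_one w
  cases K with
  | zero => exact ⟨hb, continuous_phaseDeriv.continuousOn⟩
  | succ K =>
    exact ⟨hb, _, fun w _ => hasDerivAt_phaseDeriv w,
      ((isSymbol_exp_neg_half K).const_mul _).mono (by norm_num) le_rfl⟩

/-- Bounds for the powers of a function comparable to `w ^ a` near the origin. -/
theorem symbolBound_rpow {f : ℝ → ℝ} {a γ c C D E : ℝ} (hc : 0 < c)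
    (h0 : ∀ w, 0 < w → w ≤ 1 → c * w ^ a ≤ f w ∧ f w ≤ C * w ^ a)
    (hD : 0 < D) (h1 : ∀ w, 1 ≤ w → D ≤ f w) (p : ℝ)
    (h2 : 0 ≤ p → ∀ w, 1 ≤ w → f w ^ p ≤ E * Real.exp (γ * w)) (hγ : 0 ≤ γ) :
    SymbolBound (p * a) γ (fun w => f w ^ p) := by
  have hC : 0 < C := by
    have := h0 1 one_pos le_rfl
    rw [Real.one_rpow] at this
    linarith
  refine symbolBound_of_split (max (c ^ p) (C ^ p)) (max E (D ^ p)) (fun w hw hw1 => ?_)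
    (fun w hw => ?_)
  · have hwa : 0 < w ^ a := Real.rpow_pos_of_pos hw a
    obtain ⟨hl, hu⟩ := h0 w hw hw1
    have hcw : 0 < c * w ^ a := by positivity
    have hf : 0 < f w := hcw.trans_le hl
    have e : w ^ (p * a) = (w ^ a) ^ p := by rw [mul_comm, Real.rpow_mul hw.le]
    have hn : 0 ≤ (w ^ a) ^ p := Real.rpow_nonneg hwa.le _
    rw [abs_of_nonneg (Real.rpow_nonneg hf.le _), e]
    rcases le_total 0 p with hp | hp
    · refine (Real.rpow_le_rpow hf.le hu hp).trans ?_
      rw [Real.mul_rpow hC.le hwa.le]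
      exact mul_le_mul_of_nonneg_right (le_max_right _ _) hn
    · refine (Real.rpow_le_rpow_of_nonpos hcw hl hp).trans ?_
      rw [Real.mul_rpow hc.le hwa.le]
      exact mul_le_mul_of_nonneg_right (le_max_left _ _) hn
  · have hf : 0 < f w := hD.trans_le (h1 w hw)
    rw [abs_of_nonneg (Real.rpow_nonneg hf.le _)]
    have hexp : 1 ≤ Real.exp (γ * w) := Real.one_le_exp (by positivity)
    rcases le_total 0 p with hp | hp
    · exact (h2 hp w hw).trans (mul_le_mul_of_nonneg_right (le_max_left _ _) (by linarith))
    · refine (Real.rpow_le_rpow_of_nonpos hD (h1 w hw) hp).trans ?_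
      have : 0 ≤ D ^ p := Real.rpow_nonneg hD.le _
      have h3 : D ^ p ≤ max E (D ^ p) := le_max_right _ _
      nlinarith

/-- The price of one integration by parts: one order lost at the origin, where the phase is
stationary, and nothing at infinity, where its derivative stays away from zero. -/
theorem isSymbol_inv_phaseDeriv (K : ℕ) : IsSymbol K (-1) 0 (fun w => (phaseDeriv w)⁻¹) := by
  have h := isSymbol_rpow_comp (f := phaseDeriv) (a := 1) (γ := 0) (fun w hw => phaseDeriv_pos hw)
    (fun w _ => hasDerivAt_phaseDeriv w)
    (fun K => ((isSymbol_exp_neg_half K).const_mul _).mono (by norm_num) le_rfl)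
    (fun p => symbolBound_rpow (c := 1 / 4) (C := 1 / 2) (D := 1 / 4) (E := 1) (by norm_num)
      (fun w h0 h1 => by
        have := phaseDeriv_ge_of_le_one h0 h1
        have := phaseDeriv_le (x := w)
        rw [Real.rpow_one]
        constructor <;> linarith) (by norm_num)
      (fun w h1 => phaseDeriv_ge_of_one_le h1) p (fun hp w h1 => by
        simpa using Real.rpow_le_one (phaseDeriv_pos (by linarith)).le (phaseDeriv_le_one w) hp)
      le_rfl) K (-1)
  refine (h.mono (by norm_num) le_rfl).congr fun w hw => ?_
  rw [Real.rpow_neg_one]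

/-- The rate `1/4` only has to be below `1`, so that the factor `exp (-phase w)` of the model
density still wins at infinity. -/
theorem isSymbol_phase_rpow (K : ℕ) (p : ℝ) : IsSymbol K (2 * p) (1 / 4) (fun w => phase w ^ p) := by
  have h := isSymbol_rpow_comp (f := phase) (a := 2) (γ := 1 / 4) (fun w hw => phase_pos hw)
    (fun w _ => hasDerivAt_phase w)
    (fun K => (isSymbol_phaseDeriv K).mono (by norm_num) le_rfl)
    (fun p => by
      obtain ⟨E, -, hE'⟩ := exists_rpow_le_mul_exp p (δ := 1 / 4) (by norm_num)
      exact symbolBound_rpow (c := 1 / 6) (C := 1 / 3) (D := 1 / 6) (E := E) (by norm_num)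
        (fun w h0 h1 => by
          have := phase_ge_of_le_one h0 h1
          have := phase_le_of_le_one h0 h1
          rw [Real.rpow_two]
          constructor <;> linarith) (by norm_num)
        (fun w h1 => phase_ge_of_one_le h1) p
        (fun hp w h1 => (Real.rpow_le_rpow (phase_pos (by linarith)).le
          (phase_le_self (by linarith)) hp).trans (hE' w h1)) (by norm_num)) K p
  rwa [mul_comm] at h

theorem hasDerivAt_exp_neg_phase (w : ℝ) :
    HasDerivAt (fun w => Real.exp (-phase w)) (-1 * (phaseDeriv w * Real.exp (-phase w))) w := by
  convert! (hasDerivAt_phase w).fun_neg.exp using 1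
  ring

theorem isSymbol_exp_neg_phase (K : ℕ) : IsSymbol K 0 (-1) (fun w => Real.exp (-phase w)) := by
  have hb : SymbolBound 0 (-1) (fun w => Real.exp (-phase w)) := by
    refine ⟨Real.exp 2, fun w hw => ?_⟩
    rw [Real.abs_exp, symbolWeight, Real.rpow_zero, one_mul, ← Real.exp_add]
    refine Real.exp_le_exp.2 ?_
    unfold phase
    linarith [Real.exp_pos (-w / 2)]
  induction K with
  | zero => exact ⟨hb, by have := continuous_phase; fun_prop⟩
  | succ K ih =>
    exact ⟨hb, _, fun w _ => hasDerivAt_exp_neg_phase w,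
      (((isSymbol_phaseDeriv K).mul ih).const_mul (-1)).mono (by norm_num) (by norm_num)⟩

/-- The true order is two; order one is all that the comparison with `w ^ β` needs. -/
theorem isSymbol_exp_neg_phase_sub_one (K : ℕ) :
    IsSymbol K 1 0 (fun w => Real.exp (-phase w) - 1) := by
  have hb : SymbolBound 1 0 (fun w => Real.exp (-phase w) - 1) := by
    have h1 : ∀ w, 0 < w → |Real.exp (-phase w) - 1| ≤ phase w ∧ |Real.exp (-phase w) - 1| ≤ 1 :=
      fun w hw => by
        have h2 : Real.exp (-phase w) ≤ 1 := Real.exp_le_one_iff.2 (by linarith [phase_pos hw])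
        rw [abs_of_nonpos (by linarith)]
        constructor
        · linarith [Real.add_one_le_exp (-phase w)]
        · linarith [Real.exp_pos (-phase w)]
    refine symbolBound_of_split 1 1 (fun w hw _ => ?_) (fun w hw => ?_)
    · rw [Real.rpow_one, one_mul]
      exact (h1 w hw).1.trans (phase_le_self hw)
    · simpa using (h1 w (by linarith)).2
  cases K with
  | zero => exact ⟨hb, by have := continuous_phase; fun_prop⟩
  | succ K =>
    exact ⟨hb, _, fun w _ => (hasDerivAt_exp_neg_phase w).sub_const 1,
      (((isSymbol_phaseDeriv K).mul (isSymbol_exp_neg_phase K)).const_mul (-1)).mono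
        (by norm_num) (by norm_num)⟩

theorem isSymbol_phaseDeriv_sub (K : ℕ) : IsSymbol K 2 1 (fun w => phaseDeriv w - w / 2) := by
  have hb : SymbolBound 2 1 (fun w => phaseDeriv w - w / 2) := by
    refine symbolBound_of_split 1 1 (fun w hw h1 => ?_) (fun w hw => ?_)
    · rw [Real.rpow_two]
      refine (abs_phaseDeriv_sub_le hw h1).trans ?_
      nlinarith
    · have := phaseDeriv_pos (x := w) (by linarith)
      have := phaseDeriv_le (x := w)
      rw [abs_of_nonpos (by linarith), one_mul, one_mul]
      linarith [Real.add_one_le_exp w]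
  cases K with
  | zero => exact ⟨hb, by have := continuous_phaseDeriv; fun_prop⟩
  | succ K =>
    refine ⟨hb, fun w => -(1 / 2) * phaseDeriv w, fun w _ => ?_,
      ((isSymbol_phaseDeriv K).const_mul _).mono (by norm_num) (by norm_num)⟩
    convert! (hasDerivAt_phaseDeriv w).sub ((hasDerivAt_id w).div_const 2) using 1
    unfold phaseDeriv
    ring

theorem exists_abs_rpow_sub_one_le (p : ℝ) {a b : ℝ} (ha : 0 < a) (ha1 : a ≤ 1) (hb : 1 ≤ b) :
    ∃ C, 0 ≤ C ∧ ∀ z ∈ Icc a b, |z ^ p - 1| ≤ C * |z - 1| := by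
  have hcont : ContinuousOn (fun z : ℝ => |p * z ^ (p - 1)|) (Icc a b) := by
    refine (ContinuousOn.mul continuousOn_const fun z hz => ?_).abs
    exact (Real.continuousAt_rpow_const z _ (Or.inl (ha.trans_le hz.1).ne')).continuousWithinAt
  obtain ⟨C, hC⟩ := isCompact_Icc.bddAbove_image hcont
  have hC' : ∀ z ∈ Icc a b, ‖p * z ^ (p - 1)‖ ≤ C := fun z hz => hC (mem_image_of_mem _ hz)
  refine ⟨C, (norm_nonneg _).trans (hC' a ⟨le_rfl, by linarith⟩), fun z hz => ?_⟩
  have := (convex_Icc a b).norm_image_sub_le_of_norm_hasDerivWithin_le (f := fun z : ℝ => z ^ p)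
    (f' := fun z => p * z ^ (p - 1)) (C := C) (x := 1) (y := z) (fun x hx =>
      (Real.hasDerivAt_rpow_const (Or.inl (ha.trans_le hx.1).ne')).hasDerivWithinAt) hC'
      ⟨ha1, hb⟩ hz
  simpa using this

theorem symbolBound_phase_rpow_sub (p : ℝ) :
    SymbolBound (2 * p + 1) 1 (fun w => phase w ^ p - (1 / 4) ^ p * w ^ (2 * p)) := by
  obtain ⟨C, hC0, hC⟩ := exists_abs_rpow_sub_one_le p (a := 2 / 3) (b := 4 / 3) (by norm_num)
    (by norm_num) (by norm_num)
  obtain ⟨D, hD0, hD⟩ := (isSymbol_phase_rpow 0 p).bound.exists_pos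
  obtain ⟨E, hE0, hE⟩ := exists_rpow_le_mul_exp (2 * p) one_pos
  refine symbolBound_of_split ((1 / 4) ^ p * C) (D + (1 / 4) ^ p * E) (fun w h0 h1 => ?_)
    (fun w h1 => ?_)
  · have hw2 : 0 < w ^ 2 := by positivity
    -- Factor out the quadratic part: `z` stays in `[2/3, 4/3]` and is within `w` of `1`, so `z ^ p
    -- - 1` is `O(w)`, the extra order claimed.
    set z := phase w / (w ^ 2 / 4) with hz
    have hzw : phase w = 1 / 4 * w ^ 2 * z := by rw [hz]; field_simp
    have hzmem : z ∈ Icc (2 / 3 : ℝ) (4 / 3) := by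
      have := phase_ge_of_le_one h0 h1
      have := phase_le_of_le_one h0 h1
      constructor <;> nlinarith
    have hz1 : |z - 1| ≤ w := by
      have h := abs_phase_sub_le h0 h1
      rw [hzw, show 1 / 4 * w ^ 2 * z - w ^ 2 / 4 = w ^ 2 / 4 * (z - 1) by ring, abs_mul,
        abs_of_pos (by positivity)] at h
      have : w ^ 2 * |z - 1| ≤ w ^ 2 * w := by nlinarith
      exact le_of_mul_le_mul_left this hw2
    have hz0 : 0 ≤ z := by linarith [hzmem.1]
    have e2 : w ^ (2 * p) = (w ^ 2) ^ p := by rw [Real.rpow_mul h0.le, Real.rpow_two]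
    have e : phase w ^ p - (1 / 4) ^ p * w ^ (2 * p) = (1 / 4) ^ p * w ^ (2 * p) * (z ^ p - 1) := by
      rw [hzw, Real.mul_rpow (by positivity) hz0, Real.mul_rpow (by norm_num) hw2.le, e2]
      ring
    rw [e, abs_mul, abs_of_nonneg (by positivity), Real.rpow_add h0, Real.rpow_one]
    have h3 : |z ^ p - 1| ≤ C * w := (hC z hzmem).trans (mul_le_mul_of_nonneg_left hz1 hC0)
    calc (1 / 4) ^ p * w ^ (2 * p) * |z ^ p - 1| ≤ (1 / 4) ^ p * w ^ (2 * p) * (C * w) :=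
          mul_le_mul_of_nonneg_left h3 (by positivity)
      _ = _ := by ring
  · have hw : 0 < w := by linarith
    refine (abs_sub _ _).trans ?_
    have h2 := hD w hw
    rw [symbolWeight_of_one_le h1] at h2
    have h3 : Real.exp (1 / 4 * w) ≤ Real.exp (1 * w) := Real.exp_le_exp.2 (by linarith)
    have h4 : (0 : ℝ) ≤ (1 / 4) ^ p := by positivity
    have h5 : |(1 / 4 : ℝ) ^ p * w ^ (2 * p)| ≤ (1 / 4) ^ p * E * Real.exp (1 * w) := by
      rw [abs_of_nonneg (by positivity), mul_assoc]
      exact mul_le_mul_of_nonneg_left (hE w h1) h4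
    have h6 : D * Real.exp (1 / 4 * w) ≤ D * Real.exp (1 * w) :=
      mul_le_mul_of_nonneg_left h3 hD0.le
    linarith

/-- Differentiating reproduces the same difference with exponent `p - 1`, times `phaseDeriv`, plus a
multiple of `phaseDeriv w - w / 2`; hence the induction over all `p`. The growing rate `1 + K` is
harmless, because only the behaviour near `0` is used. -/
theorem isSymbol_phase_rpow_sub (K : ℕ) (p : ℝ) :
    IsSymbol K (2 * p + 1) (1 + K) (fun w => phase w ^ p - (1 / 4) ^ p * w ^ (2 * p)) := by
  induction K generalizing p with
  | zero =>
    refine ⟨(symbolBound_phase_rpow_sub p).mono le_rfl (by simp), ?_⟩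
    exact (isSymbol_phase_rpow 0 p).continuousOn.sub
      (continuousOn_const.mul (isSymbol_rpow 0 (2 * p)).continuousOn)
  | succ K ih =>
    refine ⟨(symbolBound_phase_rpow_sub p).mono le_rfl (by push_cast; linarith),
      fun w => p * (phaseDeriv w * (phase w ^ (p - 1) - (1 / 4) ^ (p - 1) * w ^ (2 * (p - 1)))
        + (1 / 4) ^ (p - 1) * (w ^ (2 * p - 2) * (phaseDeriv w - w / 2))), fun w hw => ?_, ?_⟩
    · convert! ((hasDerivAt_phase w).rpow_const (p := p) (Or.inl (phase_pos hw).ne')).sub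
        ((Real.hasDerivAt_rpow_const (x := w) (p := 2 * p) (Or.inl hw.ne')).const_mul
          ((1 / 4 : ℝ) ^ p)) using 1
      have e1 : (1 / 4 : ℝ) ^ p = (1 / 4) ^ (p - 1) * (1 / 4) := by
        rw [← Real.rpow_add_one (by norm_num)]; ring_nf
      have e2 : w ^ (2 * p - 1) = w ^ (2 * p - 2) * w := by
        rw [← Real.rpow_add_one hw.ne']; ring_nf
      rw [e1, e2, show 2 * (p - 1) = 2 * p - 2 by ring]
      ring
    · refine IsSymbol.const_mul (IsSymbol.add ?_ (IsSymbol.const_mul ?_ _)) _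
      · exact ((isSymbol_phaseDeriv K).mul (ih (p - 1))).mono (by linarith)
          (by push_cast; linarith)
      · exact ((isSymbol_rpow K (2 * p - 2)).mul (isSymbol_phaseDeriv_sub K)).mono (by linarith)
          (by push_cast; have : (0 : ℝ) ≤ K := K.cast_nonneg; linarith)

/-! ### The model density. -/

/-- A density on the half-line that behaves like `w ^ β` at the origin and whose oscillatory
integral against the phase is an Euler integral. -/
noncomputable def modelDensity (β w : ℝ) : ℝ :=
  2 * 4 ^ ((β - 1) / 2) * (phase w ^ ((β - 1) / 2) * (Real.exp (-phase w) * phaseDeriv w))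

theorem isSymbol_modelDensity (K : ℕ) (β : ℝ) : IsSymbol K β (-(3 / 4)) (modelDensity β) := by
  refine IsSymbol.const_mul (IsSymbol.mono ((isSymbol_phase_rpow K _).mul
    ((isSymbol_exp_neg_phase K).mul (isSymbol_phaseDeriv K))) ?_ ?_) _ <;> linarith

/-- Replace `phase w ^ p`, `exp (-phase w)` and `phaseDeriv w` in turn by `(1/4) ^ p * w ^ (2p)`,
`1` and `w / 2`. The constant in front normalises the result to `w ^ β`, and each replacement costs
a term of one order more. -/
theorem isSymbol_modelDensity_sub (K : ℕ) (β : ℝ) :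
    IsSymbol K (β + 1) (2 + K) (fun w => modelDensity β w - w ^ β) := by
  have hK : (0 : ℝ) ≤ K := K.cast_nonneg
  set p := (β - 1) / 2 with hp
  have h1 := ((isSymbol_phase_rpow_sub K p).mul
    ((isSymbol_exp_neg_phase K).mul (isSymbol_phaseDeriv K))).const_mul (2 * 4 ^ p)
  have h2 := ((isSymbol_rpow K (2 * p)).mul
    ((isSymbol_exp_neg_phase_sub_one K).mul (isSymbol_phaseDeriv K))).const_mul 2
  have h3 := ((isSymbol_rpow K (2 * p)).mul (isSymbol_phaseDeriv_sub K)).const_mul 2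
  refine (((h1.mono (α' := β + 1) (γ' := 2 + K) (by rw [hp]; linarith) (by linarith)).add
    (h2.mono (by rw [hp]; linarith) (by linarith))).add
    (h3.mono (by rw [hp]; linarith) (by linarith))).congr fun w hw => ?_
  have e1 : w ^ β = w ^ (2 * p) * w := by
    rw [← Real.rpow_add_one hw.ne', hp]; ring_nf
  have e2 : (4 : ℝ) ^ p * (1 / 4) ^ p = 1 := by
    rw [← Real.mul_rpow (by norm_num) (by norm_num)]; norm_num
  rw [modelDensity, ← hp, e1]
  linear_combination (2 * w ^ (2 * p) * Real.exp (-phase w) * phaseDeriv w) * e2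

/-! ### The oscillating factor and integration by parts. -/

/-- The oscillating factor `exp (-i t phase)`. -/
noncomputable def osc (t x : ℝ) : ℂ := Complex.exp (((-(t * phase x) : ℝ) : ℂ) * Complex.I)

theorem norm_osc (t x : ℝ) : ‖osc t x‖ = 1 := Complex.norm_exp_ofReal_mul_I _

theorem continuous_osc (t : ℝ) : Continuous (osc t) := by
  have := continuous_phase
  unfold osc
  fun_prop

theorem hasDerivAt_osc (t x : ℝ) :
    HasDerivAt (osc t) (-(t * phaseDeriv x : ℝ) * Complex.I * osc t x) x := by
  have h1 : HasDerivAt (fun x => ((-(t * phase x) : ℝ) : ℂ)) ((-(t * phaseDeriv x) : ℝ) : ℂ) x :=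
    ((hasDerivAt_phase x).const_mul t).fun_neg.ofReal_comp
  have := (h1.mul_const Complex.I).cexp
  convert! this using 1
  rw [osc]
  push_cast
  ring

theorem integrableOn_mul_osc {F : ℝ → ℝ} {s : Set ℝ} (hF : IntegrableOn F s) (t y : ℝ) :
    IntegrableOn (fun w => (F w : ℂ) * osc t (w + y)) s := by
  refine Integrable.mul_bdd (c := 1) hF.ofReal ?_ (Eventually.of_forall fun w => (norm_osc _ _).le)
  exact ((continuous_osc t).comp (continuous_add_const y)).aestronglyMeasurable

theorem norm_integral_mul_osc_le (F : ℝ → ℝ) (s : Set ℝ) (t y : ℝ) :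
    ‖∫ w in s, (F w : ℂ) * osc t (w + y)‖ ≤ ∫ w in s, |F w| := by
  refine (norm_integral_le_integral_norm _).trans (le_of_eq ?_)
  simp [norm_osc]

/-- Integration by parts against the oscillating factor. -/
theorem norm_integral_mul_phaseDeriv_osc_le {F F' : ℝ → ℝ} {a y t l : ℝ} (ht : 0 < t)
    (hF : ∀ w ∈ Ioi a, HasDerivAt F (F' w) w)
    (hint : IntegrableOn (fun w => F w * phaseDeriv (w + y)) (Ioi a))
    (hint' : IntegrableOn F' (Ioi a)) (hlim : Tendsto F (𝓝[>] a) (𝓝 l))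
    (htop : Tendsto F atTop (𝓝 0)) :
    ‖∫ w in Ioi a, ((F w * phaseDeriv (w + y) : ℝ) : ℂ) * osc t (w + y)‖
      ≤ t⁻¹ * (|l| + ‖∫ w in Ioi a, (F' w : ℂ) * osc t (w + y)‖) := by
  have hv : ∀ w ∈ Ioi a, HasDerivAt (fun w => osc t (w + y))
      (-(t * phaseDeriv (w + y) : ℝ) * Complex.I * osc t (w + y)) w := fun w _ =>
    (hasDerivAt_osc t (w + y)).comp_add_const w y
  -- Differentiating `osc` produces `-it · phaseDeriv`: the amplitude supplies the factor
  -- `phaseDeriv`, and `-it` is the gain of `t⁻¹`.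
  have e : ∀ w, (F w : ℂ) * (-(t * phaseDeriv (w + y) : ℝ) * Complex.I * osc t (w + y))
      = (-(t : ℂ) * Complex.I) * (((F w * phaseDeriv (w + y) : ℝ) : ℂ) * osc t (w + y)) := by
    intro w; push_cast; ring
  have hcont : Continuous fun w => osc t (w + y) := (continuous_osc t).comp (continuous_add_const y)
  have key := integral_Ioi_mul_deriv_eq_deriv_mul (fun w hw => (hF w hw).ofReal_comp) hv
    (a' := (l : ℂ) * osc t (a + y)) (b' := 0)
    (by
      have := (integrableOn_mul_osc hint t y).const_mul (-(t : ℂ) * Complex.I)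
      refine this.congr (Eventually.of_forall fun w => ?_)
      exact (e w).symm)
    (integrableOn_mul_osc hint' t y)
    (((Complex.continuous_ofReal.tendsto l).comp hlim).mul
      ((hcont.tendsto a).mono_left nhdsWithin_le_nhds))
    (by
      rw [tendsto_zero_iff_norm_tendsto_zero] at htop ⊢
      refine htop.congr fun w => ?_
      simp [norm_osc])
  simp_rw [e] at key
  rw [integral_const_mul] at key
  have h2 := congrArg norm key
  rw [norm_mul, norm_mul, norm_neg, Complex.norm_I, Complex.norm_real, mul_one,
    Real.norm_of_nonneg ht.le] at h2
  rw [← div_eq_inv_mul, le_div_iff₀' ht, h2]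
  refine (norm_sub_le _ _).trans (add_le_add_left ?_ _)
  simp [norm_osc]

/-- Integration by parts for a product of an amplitude and a symbol, `e` being the symbol divided
by the derivative of the phase. -/
theorem norm_integral_mul_osc_step {f f' c e e' : ℝ → ℝ} {a y t l : ℝ} (ht : 0 < t) (ha : 0 ≤ a)
    (hy : 0 ≤ y) (hf : ∀ w, 0 < w → HasDerivAt f (f' w) w)
    (hc : ∀ w, 0 < w → e w = c w * (phaseDeriv w)⁻¹) (he : ∀ w, 0 < w → HasDerivAt e (e' w) w)
    (h1 : IntegrableOn (fun w => f w * c (w + y)) (Ioi a))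
    (h2 : IntegrableOn (fun w => f' w * e (w + y)) (Ioi a))
    (h3 : IntegrableOn (fun w => f w * e' (w + y)) (Ioi a))
    (hlim : Tendsto (fun w => f w * e (w + y)) (𝓝[>] a) (𝓝 l))
    (htop : Tendsto (fun w => f w * e (w + y)) atTop (𝓝 0)) :
    ‖∫ w in Ioi a, ((f w * c (w + y) : ℝ) : ℂ) * osc t (w + y)‖
      ≤ t⁻¹ * (|l| + (‖∫ w in Ioi a, ((f' w * e (w + y) : ℝ) : ℂ) * osc t (w + y)‖
        + ‖∫ w in Ioi a, ((f w * e' (w + y) : ℝ) : ℂ) * osc t (w + y)‖)) := by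
  have hpos : ∀ w ∈ Ioi a, 0 < w := fun w hw => lt_of_le_of_lt ha hw
  have e1 : ∀ w ∈ Ioi a, f w * c (w + y) = (f w * e (w + y)) * phaseDeriv (w + y) := by
    intro w hw
    have h0 : 0 < w + y := by linarith [hpos w hw]
    rw [hc _ h0]
    field_simp [(phaseDeriv_pos h0).ne']
  rw [setIntegral_congr_fun measurableSet_Ioi (fun w hw => by rw [e1 w hw])]
  refine (norm_integral_mul_phaseDeriv_osc_le ht
    (F' := fun w => f' w * e (w + y) + f w * e' (w + y)) (fun w hw => ?_)
    (h1.congr_fun e1 measurableSet_Ioi) (h2.add h3) hlim htop).trans ?_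
  · exact (hf w (hpos w hw)).mul ((he _ (by linarith [hpos w hw])).comp_add_const w y)
  · refine mul_le_mul_of_nonneg_left (add_le_add_right ?_ _) (inv_nonneg.2 ht.le)
    refine le_trans (le_of_eq ?_) (norm_add_le _ _)
    rw [← integral_add (integrableOn_mul_osc h2 t y) (integrableOn_mul_osc h3 t y)]
    congr 2
    ext w
    push_cast
    ring

/-! ### Decay of oscillatory integrals, away from the stationary point and at it. -/

/-- `f k` is the `k`-th derivative of an amplitude on the half-line that behaves like `w ^ α` at the
origin, together with its derivatives, and has integrable derivatives at infinity. -/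
structure EndpointRegular (α : ℝ) (f : ℕ → ℝ → ℝ) : Prop where
  hasDerivAt : ∀ k w, 0 < w → HasDerivAt (f k) (f (k + 1) w) w
  bound : ∀ k, ∃ C, ∀ w, 0 < w → w ≤ 1 → |f k w| ≤ C * w ^ (α - k)
  integrable : ∀ k, IntegrableOn (f k) (Ioi 1)

theorem EndpointRegular.mono {α α' : ℝ} {f : ℕ → ℝ → ℝ} (h : EndpointRegular α f) (hα : α' ≤ α) :
    EndpointRegular α' f where
  hasDerivAt := h.hasDerivAt
  integrable := h.integrable
  bound k := by
    obtain ⟨C, hC⟩ := h.bound k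
    refine ⟨|C|, fun w h0 h1 => (hC w h0 h1).trans ?_⟩
    exact mul_le_mul (le_abs_self C)
      (Real.rpow_le_rpow_of_exponent_ge h0 h1 (by linarith)) (Real.rpow_nonneg h0.le _)
      (abs_nonneg C)

theorem EndpointRegular.continuousOn {α : ℝ} {f : ℕ → ℝ → ℝ} (h : EndpointRegular α f) (k : ℕ) :
    ContinuousOn (f k) (Ioi 0) :=
  fun w hw => (h.hasDerivAt k w hw).continuousAt.continuousWithinAt

theorem EndpointRegular.tendsto_atTop {α : ℝ} {f : ℕ → ℝ → ℝ} (h : EndpointRegular α f) (k : ℕ) :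
    Tendsto (f k) atTop (𝓝 0) :=
  tendsto_zero_of_hasDerivAt_of_integrableOn_Ioi
    (fun w hw => h.hasDerivAt k w (zero_lt_one.trans hw)) (h.integrable (k + 1)) (h.integrable k)

theorem integrableOn_Ioi_of_bound {F : ℝ → ℝ} {C σ : ℝ} (hF : ContinuousOn F (Ioi 0))
    (h0 : ∀ w, 0 < w → w ≤ 1 → |F w| ≤ C * w ^ σ) (hσ : -1 < σ) (h1 : IntegrableOn F (Ioi 1)) :
    IntegrableOn F (Ioi 0) := by
  rw [← Ioc_union_Ioi_eq_Ioi zero_le_one]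
  refine IntegrableOn.union ?_ h1
  have hi : IntegrableOn (fun w : ℝ => C * w ^ σ) (Ioc 0 1) :=
    ((intervalIntegrable_iff_integrableOn_Ioc_of_le zero_le_one).1
      (intervalIntegral.intervalIntegrable_rpow' hσ)).const_mul C
  refine hi.mono' ((hF.mono Ioc_subset_Ioi_self).aestronglyMeasurable measurableSet_Ioc) ?_
  filter_upwards [ae_restrict_mem measurableSet_Ioc] with w hw using h0 w hw.1 hw.2

theorem EndpointRegular.integrableOn_mul {α : ℝ} {f : ℕ → ℝ → ℝ} (h : EndpointRegular α f) (k : ℕ)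
    {c : ℝ → ℝ} {D a : ℝ} (hc : ContinuousOn c (Ioi 0))
    (hD : ∀ w, 0 < w → |c w| ≤ D * min w 1 ^ (-a)) (ha : -1 < α - k - a) :
    IntegrableOn (fun w => f k w * c w) (Ioi 0) := by
  obtain ⟨C, hC⟩ := h.bound k
  refine integrableOn_Ioi_of_bound (C := C * D) (σ := α - k - a) ((h.continuousOn k).mul hc)
    (fun w h0 h1 => ?_) ha ?_
  · have h2 := hD w h0
    rw [min_eq_left h1] at h2
    rw [abs_mul, sub_eq_add_neg _ a, Real.rpow_add h0, mul_mul_mul_comm]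
    exact mul_le_mul (hC w h0 h1) h2 (abs_nonneg _) ((abs_nonneg _).trans (hC w h0 h1))
  · refine Integrable.mul_bdd (c := D) (h.integrable k)
      ((hc.mono (Ioi_subset_Ioi zero_le_one)).aestronglyMeasurable measurableSet_Ioi) ?_
    filter_upwards [ae_restrict_mem measurableSet_Ioi] with w hw
    have := hD w (zero_lt_one.trans hw)
    rwa [min_eq_right (le_of_lt hw), Real.one_rpow, mul_one] at this

theorem tendsto_mul_atTop_of_bound {f c : ℝ → ℝ} {D : ℝ} (hf : Tendsto f atTop (𝓝 0))
    (hD : ∀ w, 1 ≤ w → |c w| ≤ D) : Tendsto (fun w => f w * c w) atTop (𝓝 0) := by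
  refine hf.zero_mul_isBoundedUnder_le ?_
  refine isBoundedUnder_of_eventually_le (a := D) ?_
  filter_upwards [eventually_ge_atTop 1] with w hw using hD w hw

theorem tendsto_mul_zero_of_bound {F : ℝ → ℝ} {C σ : ℝ} (hσ : 0 < σ)
    (h : ∀ w, 0 < w → w ≤ 1 → |F w| ≤ C * w ^ σ) : Tendsto F (𝓝[>] 0) (𝓝 0) := by
  have h1 : Tendsto (fun w : ℝ => C * w ^ σ) (𝓝[>] 0) (𝓝 0) := by
    have := ((Real.continuousAt_rpow_const 0 σ (Or.inr hσ.le)).tendsto.const_mul C)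
    rw [Real.zero_rpow hσ.ne', mul_zero] at this
    exact this.mono_left nhdsWithin_le_nhds
  refine squeeze_zero_norm' ?_ h1
  filter_upwards [Ioc_mem_nhdsGT zero_lt_one] with w hw using h w hw.1 hw.2

theorem IsSymbol.exists_abs_le {K : ℕ} {q : ℝ} {c : ℝ → ℝ} (hc : IsSymbol K (-q) 0 c) :
    ∃ D, 0 < D ∧ ∀ w, 0 < w → |c w| ≤ D * min w 1 ^ (-q) := by
  obtain ⟨D, h0, hD⟩ := hc.bound.exists_pos
  exact ⟨D, h0, fun w hw => by simpa [symbolWeight] using hD w hw⟩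

/-- Distributes a singularity in `w + y` between `w` and `y`, using that `w + y` dominates both. -/
theorem min_add_rpow_neg_le {q a b w y : ℝ} (hw : 0 < w) (hy : 0 < y) (ha : 0 ≤ a) (hb : 0 ≤ b)
    (hab : q ≤ a + b) : min (w + y) 1 ^ (-q) ≤ min w 1 ^ (-a) * min y 1 ^ (-b) := by
  have h0 : 0 < min (w + y) 1 := lt_min (by linarith) one_pos
  have h1 : min (w + y) 1 ^ (-q) ≤ min (w + y) 1 ^ (-a + -b) :=
    Real.rpow_le_rpow_of_exponent_ge h0 (min_le_right _ _) (by linarith)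
  refine h1.trans ?_
  rw [Real.rpow_add h0]
  have h2 : min (w + y) 1 ^ (-a) ≤ min w 1 ^ (-a) :=
    Real.rpow_le_rpow_of_nonpos (lt_min hw one_pos)
      (min_le_min_right _ (by linarith)) (by linarith)
  have h3 : min (w + y) 1 ^ (-b) ≤ min y 1 ^ (-b) :=
    Real.rpow_le_rpow_of_nonpos (lt_min hy one_pos)
      (min_le_min_right _ (by linarith)) (by linarith)
  exact mul_le_mul h2 h3 (Real.rpow_nonneg h0.le _) (Real.rpow_nonneg (lt_min hw one_pos).le _)

theorem continuousOn_comp_add_const {c : ℝ → ℝ} {y : ℝ} (hc : ContinuousOn c (Ioi 0))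
    (hy : 0 ≤ y) : ContinuousOn (fun w => c (w + y)) (Ioi 0) :=
  hc.comp (continuous_add_const y).continuousOn fun w hw => by
    have : 0 < w := hw
    exact mem_Ioi.2 (by linarith)

/-- Decay of the oscillatory integral when the phase is shifted away from its stationary point,
with the dependence on the shift. -/
theorem EndpointRegular.exists_norm_integral_shift_le {α : ℝ} {f : ℕ → ℝ → ℝ}
    (h : EndpointRegular α f) (j : ℕ) : ∀ (k : ℕ) (q b : ℝ) (c : ℝ → ℝ), IsSymbol j (-q) 0 c →
      0 ≤ q → 0 ≤ b → -1 < α - k - j → -1 < α - k - q - 2 * j + b →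
      ∃ C, ∀ y t, 0 < y → 0 < t →
        ‖∫ w in Ioi 0, ((f k w * c (w + y) : ℝ) : ℂ) * osc t (w + y)‖
          ≤ C * (t⁻¹ ^ j * min y 1 ^ (-b)) := by
  induction j with
  | zero =>
    intro k q b c hc hq hb hk hkb
    obtain ⟨D, hD0, hD⟩ := hc.exists_abs_le
    -- The part of the singularity not charged to `y`; the amplitude must absorb it at `w = 0`.
    set a := max (q - b) 0 with ha
    have ha0 : 0 ≤ a := le_max_right _ _
    have hka : -1 < α - k - a := by
      simp only [Nat.cast_zero] at hk hkb
      rcases max_choice (q - b) 0 with h' | h' <;> rw [ha, h'] <;> linarith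
    have hmin : ContinuousOn (fun w : ℝ => min w 1 ^ (-a)) (Ioi 0) := 
      (by fun_prop : ContinuousOn (fun w : ℝ => min w 1) (Ioi 0)).rpow_const fun w hw =>
        Or.inl (lt_min hw one_pos).ne'
    have hint : IntegrableOn (fun w => f k w * min w 1 ^ (-a)) (Ioi 0) :=
      h.integrableOn_mul k (D := 1) hmin (fun w hw => by
        rw [one_mul, abs_of_nonneg (Real.rpow_nonneg (lt_min hw one_pos).le _)]) hka
    refine ⟨D * ∫ w in Ioi 0, |f k w * min w 1 ^ (-a)|, fun y t hy _ => ?_⟩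
    refine (norm_integral_mul_osc_le (fun w => f k w * c (w + y)) _ t y).trans ?_
    rw [pow_zero, one_mul, mul_right_comm, ← integral_const_mul]
    refine integral_mono_of_nonneg (Eventually.of_forall fun w => abs_nonneg _)
      (hint.abs.const_mul _) ?_
    filter_upwards [ae_restrict_mem measurableSet_Ioi] with w hw
    have hw0 : 0 < w := hw
    have h1 := (hD (w + y) (by linarith)).trans (mul_le_mul_of_nonneg_left
      (min_add_rpow_neg_le hw0 hy ha0 hb (by linarith [le_max_left (q - b) 0])) hD0.le)
    rw [abs_mul, abs_mul, abs_of_nonneg (Real.rpow_nonneg (lt_min hw0 one_pos).le _)]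
    calc |f k w| * |c (w + y)| ≤ |f k w| * (D * (min w 1 ^ (-a) * min y 1 ^ (-b))) :=
          mul_le_mul_of_nonneg_left h1 (abs_nonneg _)
      _ = _ := by ring
  | succ j ih =>
    intro k q b c hc hq hb hk hkb
    push_cast at hk hkb
    have hj : (0 : ℝ) ≤ j := j.cast_nonneg
    have he := hc.mul (isSymbol_inv_phaseDeriv (j + 1))
    rw [add_zero] at he
    have he' := he
    obtain ⟨-, e', hde, hse⟩ := he'
    -- The derivative falls either on the amplitude (`k + 1`, `q + 1`) or on the divided symbol (`q
    -- + 2`). As `j` drops by one, `k + q + 2j` is unchanged and `k + j` does not grow, so both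
    -- hypotheses survive.
    obtain ⟨C₁, hC₁⟩ := ih (k + 1) (q + 1) b _ (he.pred.mono (by linarith) le_rfl) (by linarith)
      hb (by push_cast; linarith) (by push_cast; linarith)
    obtain ⟨C₂, hC₂⟩ := ih k (q + 2) b e' (hse.mono (by linarith) le_rfl) (by linarith) hb
      (by linarith) (by linarith)
    refine ⟨C₁ + C₂, fun y t hy ht => ?_⟩
    -- These bounds depend on `y`, which is harmless: they only justify integrability and the
    -- vanishing of the boundary terms. The uniform estimate comes from the induction hypothesis.
    have hbd : ∀ {K : ℕ} {q : ℝ} {c : ℝ → ℝ}, 0 ≤ q → IsSymbol K (-q) 0 c →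
        ∃ D, ∀ w, 0 < w → |c (w + y)| ≤ D := by
      intro K q c hq hc
      obtain ⟨D, hD0, hD⟩ := hc.exists_abs_le
      refine ⟨D * (min y 1 ^ (-q)), fun w hw => (hD _ (by linarith)).trans ?_⟩
      exact mul_le_mul_of_nonneg_left (Real.rpow_le_rpow_of_nonpos (lt_min hy one_pos)
        (min_le_min_right _ (by linarith)) (by linarith)) hD0.le
    have hint : ∀ {K : ℕ} {q : ℝ} {c : ℝ → ℝ} (k : ℕ), 0 ≤ q → IsSymbol K (-q) 0 c →
        -1 < α - k → IntegrableOn (fun w => f k w * c (w + y)) (Ioi 0) := by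
      intro K q c k hq hc hk
      obtain ⟨D, hD⟩ := hbd hq hc
      exact h.integrableOn_mul k (D := D) (a := 0) (continuousOn_comp_add_const hc.continuousOn hy.le)
        (fun w hw => by simpa using hD w hw) (by simpa using hk)
    have hse1 : IsSymbol (j + 1) (-(q + 1)) 0 fun w => c w * (phaseDeriv w)⁻¹ :=
      he.mono (by linarith) le_rfl
    obtain ⟨D, hD⟩ := hbd (by linarith) hse1
    obtain ⟨C₀, hC₀⟩ := h.bound k
    have hstep := norm_integral_mul_osc_step (f := f k) (f' := f (k + 1)) (c := c)
      (e := fun w => c w * (phaseDeriv w)⁻¹) (e' := e') (a := 0) (l := 0) ht le_rfl hy.le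
      (h.hasDerivAt k) (fun _ _ => rfl) hde (hint k hq hc (by linarith))
      (hint (k + 1) (by linarith) hse1 (by push_cast; linarith))
      (hint k (by linarith) (hse.mono (α' := -(q + 2)) (by linarith) le_rfl) (by linarith))
      (tendsto_mul_zero_of_bound (C := C₀ * D) (σ := α - k) (by linarith) fun w h0 h1 => by
        rw [abs_mul, mul_right_comm]
        exact mul_le_mul (hC₀ w h0 h1) (hD w h0) (abs_nonneg _)
          ((abs_nonneg _).trans (hC₀ w h0 h1)))
      (tendsto_mul_atTop_of_bound (h.tendsto_atTop k) fun w hw => hD w (by linarith))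
    refine hstep.trans ?_
    rw [abs_zero, zero_add, pow_succ', mul_assoc, mul_left_comm]
    refine mul_le_mul_of_nonneg_left ?_ (inv_nonneg.2 ht.le)
    rw [add_mul]
    exact add_le_add (hC₁ y t hy ht) (hC₂ y t hy ht)

/-- For `σ < -1` the lower end dominates; the fixed integral over `(1, ∞)` is absorbed because `ε ^
(σ + 1) ≥ 1`. -/
theorem exists_integral_Ioi_abs_le {F : ℝ → ℝ} {C σ : ℝ} (hF : ContinuousOn F (Ioi 0))
    (h0 : ∀ w, 0 < w → w ≤ 1 → |F w| ≤ C * w ^ σ) (hσ : σ < -1) (h1 : IntegrableOn F (Ioi 1)) :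
    ∃ M, 0 ≤ M ∧ ∀ ε, 0 < ε → ε ≤ 1 →
      IntegrableOn F (Ioi ε) ∧ ∫ w in Ioi ε, |F w| ≤ M * ε ^ (σ + 1) := by
  have hC : 0 ≤ C := by
    have := (abs_nonneg _).trans (h0 1 one_pos le_rfl)
    simpa using this
  have hI : 0 ≤ ∫ w in Ioi 1, |F w| := integral_nonneg fun w => abs_nonneg _
  refine ⟨C / (-(σ + 1)) + ∫ w in Ioi 1, |F w|,
    add_nonneg (div_nonneg hC (by linarith)) hI, fun ε hε hε1 => ?_⟩
  have hi : IntegrableOn (fun w : ℝ => C * w ^ σ) (Ioi ε) :=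
    (integrableOn_Ioi_rpow_of_lt hσ hε).const_mul C
  have hsub : Ioc ε 1 ⊆ Ioi 0 := fun w hw => hε.trans hw.1
  have hFi : IntegrableOn F (Ioc ε 1) := by
    refine (hi.mono_set Ioc_subset_Ioi_self).mono'
      ((hF.mono hsub).aestronglyMeasurable measurableSet_Ioc) ?_
    filter_upwards [ae_restrict_mem measurableSet_Ioc] with w hw using h0 w (hsub hw) hw.2
  refine ⟨by rw [← Ioc_union_Ioi_eq_Ioi hε1]; exact hFi.union h1, ?_⟩
  rw [← Ioc_union_Ioi_eq_Ioi hε1, setIntegral_union (Ioc_disjoint_Ioi le_rfl) measurableSet_Ioi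
    hFi.abs h1.abs, add_mul]
  refine add_le_add ?_ (le_mul_of_one_le_right hI
    (Real.one_le_rpow_of_pos_of_le_one_of_nonpos hε hε1 (by linarith)))
  calc ∫ w in Ioc ε 1, |F w| ≤ ∫ w in Ioc ε 1, C * w ^ σ :=
        setIntegral_mono_on hFi.abs (hi.mono_set Ioc_subset_Ioi_self) measurableSet_Ioc
          fun w hw => h0 w (hsub hw) hw.2
    _ ≤ ∫ w in Ioi ε, C * w ^ σ := by
        refine setIntegral_mono_set hi ?_ Ioc_subset_Ioi_self.eventuallyLE
        filter_upwards [ae_restrict_mem measurableSet_Ioi] with w hw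
        exact mul_nonneg hC (Real.rpow_nonneg (hε.trans hw).le _)
    _ = _ := by
        rw [integral_const_mul, integral_Ioi_rpow_of_lt hσ hε, div_mul_eq_mul_div, mul_div_assoc,
          div_neg, neg_div]

theorem integral_Ioc_abs_le {F : ℝ → ℝ} {C σ ε : ℝ} (hF : ContinuousOn F (Ioi 0))
    (h0 : ∀ w, 0 < w → w ≤ 1 → |F w| ≤ C * w ^ σ) (hσ : -1 < σ) (hε : 0 < ε) (hε1 : ε ≤ 1) :
    ∫ w in Ioc 0 ε, |F w| ≤ C / (σ + 1) * ε ^ (σ + 1) := by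
  have hi : IntegrableOn (fun w : ℝ => C * w ^ σ) (Ioc 0 ε) :=
    ((intervalIntegrable_iff_integrableOn_Ioc_of_le hε.le).1
      (intervalIntegral.intervalIntegrable_rpow' hσ)).const_mul C
  have hFi : IntegrableOn F (Ioc 0 ε) := by
    refine hi.mono' ((hF.mono Ioc_subset_Ioi_self).aestronglyMeasurable measurableSet_Ioc) ?_
    filter_upwards [ae_restrict_mem measurableSet_Ioc] with w hw using h0 w hw.1 (hw.2.trans hε1)
  refine (setIntegral_mono_on hFi.abs hi measurableSet_Ioc fun w hw =>
    h0 w hw.1 (hw.2.trans hε1)).trans (le_of_eq ?_)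
  rw [integral_const_mul, ← intervalIntegral.integral_of_le hε.le, integral_rpow (Or.inl hσ),
    Real.zero_rpow (by linarith), sub_zero]
  ring

/-- Decay of the oscillatory integral with a stationary point at the endpoint. -/
theorem EndpointRegular.exists_norm_integral_le {α : ℝ} {f : ℕ → ℝ → ℝ}
    (h : EndpointRegular α f) (j : ℕ) : ∀ (k : ℕ) (q : ℝ) (c : ℝ → ℝ),
      IsSymbol (j + 1) (-q) 0 c → -1 < α - k - q - 2 * j → α - k - q - 2 * j < 1 →
      ∃ C, ∀ t, 1 ≤ t →
        ‖∫ w in Ioi 0, ((f k w * c (w + 0) : ℝ) : ℂ) * osc t (w + 0)‖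
          ≤ C * t ^ (-((α - k - q + 1) / 2)) := by
  have hprod : ∀ {K : ℕ} {q : ℝ} {c : ℝ → ℝ} (k : ℕ), IsSymbol K (-q) 0 c →
      ∃ D, ∀ w, 0 < w → w ≤ 1 → |f k w * c (w + 0)| ≤ D * w ^ (α - k - q) := by
    intro K q c k hc
    obtain ⟨D, hD0, hD⟩ := hc.exists_abs_le
    obtain ⟨C, hC⟩ := h.bound k
    refine ⟨C * D, fun w h0 h1 => ?_⟩
    have h2 := hD w h0
    rw [min_eq_left h1] at h2
    rw [abs_mul, add_zero, sub_eq_add_neg _ q, Real.rpow_add h0, mul_mul_mul_comm]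
    exact mul_le_mul (hC w h0 h1) h2 (abs_nonneg _) ((abs_nonneg _).trans (hC w h0 h1))
  have hone : ∀ {K : ℕ} {q : ℝ} {c : ℝ → ℝ}, IsSymbol K (-q) 0 c →
      ∃ D, ∀ w, 1 ≤ w → |c (w + 0)| ≤ D := by
    intro K q c hc
    obtain ⟨D, hD0, hD⟩ := hc.exists_abs_le
    refine ⟨D, fun w hw => ?_⟩
    have := hD w (by linarith)
    rwa [min_eq_right hw, Real.one_rpow, mul_one, ← add_zero w] at this
  have hcont : ∀ {K : ℕ} {q : ℝ} {c : ℝ → ℝ} (k : ℕ), IsSymbol K (-q) 0 c →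
      ContinuousOn (fun w => f k w * c (w + 0)) (Ioi 0) := by
    intro K q c k hc
    exact (h.continuousOn k).mul (continuousOn_comp_add_const hc.continuousOn le_rfl)
  have hint1 : ∀ {K : ℕ} {q : ℝ} {c : ℝ → ℝ} (k : ℕ), IsSymbol K (-q) 0 c →
      IntegrableOn (fun w => f k w * c (w + 0)) (Ioi 1) := by
    intro K q c k hc
    obtain ⟨D, hD⟩ := hone hc
    refine Integrable.mul_bdd (c := D) (h.integrable k)
      (((continuousOn_comp_add_const hc.continuousOn le_rfl).mono
        (Ioi_subset_Ioi zero_le_one)).aestronglyMeasurable measurableSet_Ioi) ?_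
    filter_upwards [ae_restrict_mem measurableSet_Ioi] with w hw using hD w (le_of_lt hw)
  have hint0 : ∀ {K : ℕ} {q : ℝ} {c : ℝ → ℝ} (k : ℕ), IsSymbol K (-q) 0 c → -1 < α - k - q →
      IntegrableOn (fun w => f k w * c (w + 0)) (Ioi 0) := by
    intro K q c k hc hk
    obtain ⟨D, hD⟩ := hprod k hc
    exact integrableOn_Ioi_of_bound (hcont k hc) hD hk (hint1 k hc)
  induction j with
  | zero =>
    intro k q c hc hl hu
    simp only [Nat.cast_zero, mul_zero, sub_zero] at hl hu
    have he := hc.mul (isSymbol_inv_phaseDeriv (0 + 1))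
    rw [add_zero] at he
    have he' := he
    obtain ⟨-, e', hde, hse⟩ := he'
    have hse1 : IsSymbol (0 + 1) (-(q + 1)) 0 fun w => c w * (phaseDeriv w)⁻¹ :=
      he.mono (by linarith) le_rfl
    have hse2 : IsSymbol 0 (-(q + 2)) 0 e' := hse.mono (by linarith) le_rfl
    obtain ⟨D₀, hD₀⟩ := hprod k hc
    obtain ⟨D₁, hD₁⟩ := hprod k hse1
    obtain ⟨D₂, hD₂⟩ := hprod (k + 1) hse1
    obtain ⟨D₃, hD₃⟩ := hprod k hse2
    obtain ⟨M₂, hM₂, hM₂'⟩ := exists_integral_Ioi_abs_le (hcont (k + 1) hse1) hD₂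
      (by push_cast; linarith) (hint1 (k + 1) hse1)
    obtain ⟨M₃, hM₃, hM₃'⟩ := exists_integral_Ioi_abs_le (hcont k hse2) hD₃
      (by linarith) (hint1 k hse2)
    obtain ⟨B₁, hB₁⟩ := hone hse1
    refine ⟨D₀ / (α - k - q + 1) + (D₁ + (M₂ + M₃)), fun t ht => ?_⟩
    have ht0 : 0 < t := by linarith
    -- The scale on which `t · phase` is of order one. With `σ = α - k - q` in `(-1, 1)`, the part
    -- below `ε` is `O(ε ^ (σ + 1))` by size alone, and one integration by parts above `ε` gives
    -- `t⁻¹ ε ^ (σ - 1)`, which is the same power of `t`.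
    set ε := t ^ (-(1 / 2) : ℝ) with hε
    have hε0 : 0 < ε := Real.rpow_pos_of_pos ht0 _
    have hε1 : ε ≤ 1 := Real.rpow_le_one_of_one_le_of_nonpos ht (by norm_num)
    have eε : ∀ s : ℝ, ε ^ s = t ^ (-(s / 2)) := fun s => by
      rw [hε, ← Real.rpow_mul ht0.le]; ring_nf
    obtain ⟨hi2, hb2⟩ := hM₂' ε hε0 hε1
    obtain ⟨hi3, hb3⟩ := hM₃' ε hε0 hε1
    have hi0 := hint0 k hc hl
    have hsplit : ∫ w in Ioi 0, ((f k w * c (w + 0) : ℝ) : ℂ) * osc t (w + 0)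
        = (∫ w in Ioc 0 ε, ((f k w * c (w + 0) : ℝ) : ℂ) * osc t (w + 0))
          + ∫ w in Ioi ε, ((f k w * c (w + 0) : ℝ) : ℂ) * osc t (w + 0) := by
      rw [← Ioc_union_Ioi_eq_Ioi hε0.le]
      exact setIntegral_union (Ioc_disjoint_Ioi le_rfl) measurableSet_Ioi
        (integrableOn_mul_osc (hi0.mono_set Ioc_subset_Ioi_self) t 0)
        (integrableOn_mul_osc (hi0.mono_set (Ioi_subset_Ioi hε0.le)) t 0)
    have hnear := (norm_integral_mul_osc_le (fun w => f k w * c (w + 0)) (Ioc 0 ε) t 0).trans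
      (integral_Ioc_abs_le (hcont k hc) hD₀ hl hε0 hε1)
    have hfar := norm_integral_mul_osc_step (f := f k) (f' := f (k + 1)) (c := c)
      (e := fun w => c w * (phaseDeriv w)⁻¹) (e' := e') (a := ε) (y := 0) ht0 hε0.le le_rfl
      (h.hasDerivAt k) (fun _ _ => rfl) hde (hi0.mono_set (Ioi_subset_Ioi hε0.le)) hi2 hi3
      (((hcont k hse1).continuousAt (Ioi_mem_nhds hε0)).tendsto.mono_left nhdsWithin_le_nhds)
      (tendsto_mul_atTop_of_bound (h.tendsto_atTop k) hB₁)
    have h2 := (norm_integral_mul_osc_le (fun w => f (k + 1) w * (c (w + 0) *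
      (phaseDeriv (w + 0))⁻¹)) (Ioi ε) t 0).trans hb2
    have h3 := (norm_integral_mul_osc_le (fun w => f k w * e' (w + 0)) (Ioi ε) t 0).trans hb3
    have h1 := hD₁ ε hε0 hε1
    have e1 : α - k - (q + 1) = α - k - q - 1 := by ring
    have e2 : α - ((k + 1 : ℕ) : ℝ) - (q + 1) + 1 = α - k - q - 1 := by push_cast; ring
    have e3 : α - k - (q + 2) + 1 = α - k - q - 1 := by ring
    rw [e1] at h1
    rw [e2] at h2
    rw [e3] at h3
    have ekey : t⁻¹ * ε ^ (α - k - q - 1) = ε ^ (α - k - q + 1) := by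
      rw [eε, eε, ← Real.rpow_neg_one t, ← Real.rpow_add ht0]; ring_nf
    rw [hsplit, ← eε]
    refine (norm_add_le _ _).trans ?_
    rw [add_mul]
    refine add_le_add hnear (hfar.trans ?_)
    calc _ ≤ t⁻¹ * (D₁ * ε ^ (α - k - q - 1) + (M₂ * ε ^ (α - k - q - 1)
          + M₃ * ε ^ (α - k - q - 1))) :=
          mul_le_mul_of_nonneg_left (add_le_add h1 (add_le_add h2 h3)) (inv_nonneg.2 ht0.le)
      _ = (D₁ + (M₂ + M₃)) * (t⁻¹ * ε ^ (α - k - q - 1)) := by ring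
      _ = _ := by rw [ekey]
  | succ j ih =>
    intro k q c hc hl hu
    push_cast at hl hu
    have hj : (0 : ℝ) ≤ j := j.cast_nonneg
    have he := hc.mul (isSymbol_inv_phaseDeriv (j + 1 + 1))
    rw [add_zero] at he
    have he' := he
    obtain ⟨-, e', hde, hse⟩ := he'
    have hse1 : IsSymbol (j + 1 + 1) (-(q + 1)) 0 fun w => c w * (phaseDeriv w)⁻¹ :=
      he.mono (by linarith) le_rfl
    have hse2 : IsSymbol (j + 1) (-(q + 2)) 0 e' := hse.mono (by linarith) le_rfl
    -- Both terms have their exponent at the origin lowered by two, which costs a factor `t`; the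
    -- factor `t⁻¹` of the integration by parts pays for it.
    obtain ⟨C₁, hC₁⟩ := ih (k + 1) (q + 1) _ hse1.pred (by push_cast; linarith)
      (by push_cast; linarith)
    obtain ⟨C₂, hC₂⟩ := ih k (q + 2) e' hse2 (by linarith) (by linarith)
    refine ⟨C₁ + C₂, fun t ht => ?_⟩
    have ht0 : 0 < t := by linarith
    obtain ⟨D₁, hD₁⟩ := hprod k hse1
    obtain ⟨B₁, hB₁⟩ := hone hse1
    have hstep := norm_integral_mul_osc_step (f := f k) (f' := f (k + 1)) (c := c)
      (e := fun w => c w * (phaseDeriv w)⁻¹) (e' := e') (a := 0) (y := 0) (l := 0) ht0 le_rfl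
      le_rfl (h.hasDerivAt k) (fun _ _ => rfl) hde (hint0 k hc (by linarith))
      (hint0 (k + 1) hse1 (by push_cast; linarith)) (hint0 k hse2 (by linarith))
      (tendsto_mul_zero_of_bound (by linarith) hD₁)
      (tendsto_mul_atTop_of_bound (h.tendsto_atTop k) hB₁)
    have h1 := hC₁ t ht
    have h2 := hC₂ t ht
    have e1 : -((α - ((k + 1 : ℕ) : ℝ) - (q + 1) + 1) / 2) = -((α - k - q + 1) / 2) + 1 := by
      push_cast; ring
    have e2 : -((α - k - (q + 2) + 1) / 2) = -((α - k - q + 1) / 2) + 1 := by ring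
    rw [e1, Real.rpow_add_one ht0.ne'] at h1
    rw [e2, Real.rpow_add_one ht0.ne'] at h2
    refine hstep.trans ?_
    rw [abs_zero, zero_add, ← div_eq_inv_mul, div_le_iff₀ ht0]
    calc _ ≤ _ := add_le_add h1 h2
      _ = _ := by ring

/-! ### Euler's integral with complex rate, and the asymptotics of the model. -/

/-- The integrand `e^{-x} x^{s-1} e^{-itx}` of Euler's integral with a complex rate. -/
noncomputable def eulerIntegrand (s t x : ℝ) : ℂ :=
  ((Real.exp (-x) * x ^ (s - 1) : ℝ) : ℂ) * Complex.exp (((-(t * x) : ℝ) : ℂ) * Complex.I)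

theorem integrableOn_eulerIntegrand {s : ℝ} (hs : 0 < s) (t : ℝ) :
    IntegrableOn (eulerIntegrand s t) (Ioi 0) := by
  refine Integrable.mul_bdd (c := 1) (Real.GammaIntegral_convergent hs).ofReal
    (by fun_prop) (Eventually.of_forall fun x => (Complex.norm_exp_ofReal_mul_I _).le)

theorem hasDerivAt_integral_eulerIntegrand {s : ℝ} (hs : 0 < s) (t : ℝ) :
    HasDerivAt (fun t => ∫ x in Ioi 0, eulerIntegrand s t x)
      (-Complex.I * ∫ x in Ioi 0, eulerIntegrand (s + 1) t x) t := by
  have h1 := hasDerivAt_integral_of_dominated_loc_of_deriv_le (μ := volume.restrict (Ioi 0))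
    (F := fun t x => eulerIntegrand s t x) (x₀ := t) (s := univ)
    (F' := fun t x => -Complex.I * eulerIntegrand (s + 1) t x)
    (bound := fun x => Real.exp (-x) * x ^ (s + 1 - 1)) univ_mem
    (Eventually.of_forall fun t => (integrableOn_eulerIntegrand hs t).aestronglyMeasurable)
    (integrableOn_eulerIntegrand hs t)
    (((integrableOn_eulerIntegrand (by linarith) t).const_mul _).aestronglyMeasurable) ?_
    (Real.GammaIntegral_convergent (by linarith)) ?_
  · simpa only [integral_const_mul] using h1.2
  · filter_upwards [ae_restrict_mem measurableSet_Ioi] with x hx t _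
    rw [norm_mul, norm_neg, Complex.norm_I, one_mul, eulerIntegrand, norm_mul,
      Complex.norm_exp_ofReal_mul_I, mul_one, Complex.norm_real, Real.norm_of_nonneg]
    exact mul_nonneg (Real.exp_pos _).le (Real.rpow_nonneg (le_of_lt hx) _)
  · filter_upwards [ae_restrict_mem measurableSet_Ioi] with x hx t _
    have h2 : HasDerivAt (fun t : ℝ => ((-(t * x) : ℝ) : ℂ)) ((-(1 * x) : ℝ) : ℂ) t :=
      ((hasDerivAt_id t).mul_const x).fun_neg.ofReal_comp
    have h3 := ((h2.mul_const Complex.I).cexp).const_mul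
      ((Real.exp (-x) * x ^ (s - 1) : ℝ) : ℂ)
    have e : x ^ (s + 1 - 1) = x ^ (s - 1) * x := by
      rw [← Real.rpow_add_one (ne_of_gt hx)]; ring_nf
    convert! h3 using 1
    rw [eulerIntegrand, e]
    push_cast
    ring

/-- Differentiation in `t` raises `s` by one; this recursion, an integration by parts in `x`, brings
it back and yields a linear differential equation in `t`. -/
theorem integral_eulerIntegrand_succ {s : ℝ} (hs : 0 < s) (t : ℝ) :
    (1 + t * Complex.I) * ∫ x in Ioi 0, eulerIntegrand (s + 1) t x
      = s * ∫ x in Ioi 0, eulerIntegrand s t x := by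
  have hu : ∀ x ∈ Ioi (0 : ℝ), HasDerivAt (fun x : ℝ => ((x ^ s : ℝ) : ℂ))
      ((s * x ^ (s - 1) : ℝ) : ℂ) x := fun x hx =>
    (Real.hasDerivAt_rpow_const (Or.inl (ne_of_gt hx))).ofReal_comp
  have hv : ∀ x ∈ Ioi (0 : ℝ), HasDerivAt
      (fun x : ℝ => ((Real.exp (-x) : ℝ) : ℂ) * Complex.exp (((-(t * x) : ℝ) : ℂ) * Complex.I))
      (-(1 + t * Complex.I) * (((Real.exp (-x) : ℝ) : ℂ) *
        Complex.exp (((-(t * x) : ℝ) : ℂ) * Complex.I))) x := fun x _ => by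
    have h2 : HasDerivAt (fun x : ℝ => ((-(t * x) : ℝ) : ℂ)) ((-(t * 1) : ℝ) : ℂ) x :=
      ((hasDerivAt_id x).const_mul t).fun_neg.ofReal_comp
    have h3 := (hasDerivAt_neg' x).exp.ofReal_comp.mul (h2.mul_const Complex.I).cexp
    convert! h3 using 1
    push_cast
    ring
  have e1 : ∀ x : ℝ, ((x ^ s : ℝ) : ℂ) * (-(1 + t * Complex.I) * (((Real.exp (-x) : ℝ) : ℂ) *
        Complex.exp (((-(t * x) : ℝ) : ℂ) * Complex.I)))
      = -(1 + t * Complex.I) * eulerIntegrand (s + 1) t x := fun x => by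
    rw [eulerIntegrand, add_sub_cancel_right]; push_cast; ring
  have e2 : ∀ x : ℝ, ((s * x ^ (s - 1) : ℝ) : ℂ) * (((Real.exp (-x) : ℝ) : ℂ) *
        Complex.exp (((-(t * x) : ℝ) : ℂ) * Complex.I)) = s * eulerIntegrand s t x := fun x => by
    rw [eulerIntegrand]; push_cast; ring
  have hnorm : ∀ x : ℝ, 0 < x → ‖((x ^ s : ℝ) : ℂ) * (((Real.exp (-x) : ℝ) : ℂ) *
        Complex.exp (((-(t * x) : ℝ) : ℂ) * Complex.I))‖ = x ^ s * Real.exp (-x) := fun x hx => by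
    rw [norm_mul, norm_mul, Complex.norm_exp_ofReal_mul_I, mul_one, Complex.norm_real,
      Complex.norm_real, Real.norm_of_nonneg (Real.rpow_nonneg hx.le _),
      Real.norm_of_nonneg (Real.exp_pos _).le]
  have key := integral_Ioi_mul_deriv_eq_deriv_mul hu hv (a' := 0) (b' := 0)
    (((integrableOn_eulerIntegrand (by linarith : 0 < s + 1) t).const_mul _).congr
      (Eventually.of_forall fun x => (e1 x).symm))
    (((integrableOn_eulerIntegrand hs t).const_mul _).congr
      (Eventually.of_forall fun x => (e2 x).symm)) ?_ ?_
  · simp_rw [e1, e2, integral_const_mul] at key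
    linear_combination -key
  · rw [tendsto_zero_iff_norm_tendsto_zero]
    have : Tendsto (fun x : ℝ => x ^ s * Real.exp (-x)) (𝓝[>] 0) (𝓝 0) := by
      have h : Tendsto (fun x : ℝ => x ^ s * Real.exp (-x)) (𝓝 0) (𝓝 (0 ^ s * Real.exp (-0))) :=
        ((Real.continuousAt_rpow_const 0 s (Or.inr hs.le)).mul
          (Real.continuous_exp.comp continuous_neg).continuousAt).tendsto
      rw [Real.zero_rpow hs.ne', zero_mul] at h
      exact h.mono_left nhdsWithin_le_nhds
    refine this.congr' ?_
    filter_upwards [self_mem_nhdsWithin] with x hx using (hnorm x hx).symm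
  · rw [tendsto_zero_iff_norm_tendsto_zero]
    have : Tendsto (fun x : ℝ => x ^ s * Real.exp (-x)) atTop (𝓝 0) := by
      simpa using tendsto_rpow_mul_exp_neg_mul_atTop_nhds_zero s 1 one_pos
    refine this.congr' ?_
    filter_upwards [eventually_gt_atTop 0] with x hx using (hnorm x hx).symm

theorem one_add_mul_I_mem_slitPlane (t : ℝ) : 1 + t * Complex.I ∈ Complex.slitPlane := by
  left; simp

/-- Euler's integral with the complex rate `1 + it`. -/
theorem integral_eulerIntegrand {s : ℝ} (hs : 0 < s) (t : ℝ) :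
    ∫ x in Ioi 0, eulerIntegrand s t x = Real.Gamma s * (1 + t * Complex.I) ^ (-s : ℂ) := by
  have hne : ∀ t : ℝ, (1 + t * Complex.I) ≠ 0 := fun t =>
    Complex.slitPlane_ne_zero (one_add_mul_I_mem_slitPlane t)
  -- By that equation `(1 + it) ^ s` times the integral is constant in `t`; its value at `t = 0` is
  -- `Γ(s)`.
  have hd : ∀ t : ℝ, HasDerivAt
      (fun t : ℝ => (1 + t * Complex.I) ^ (s : ℂ) * ∫ x in Ioi 0, eulerIntegrand s t x) 0 t := by
    intro t
    have h1 : HasDerivAt (fun z : ℂ => 1 + z * Complex.I) (1 * Complex.I) (t : ℂ) :=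
      ((hasDerivAt_id (t : ℂ)).mul_const Complex.I).const_add 1
    have h2 := (h1.cpow_const (c := (s : ℂ)) (one_add_mul_I_mem_slitPlane t)).comp_ofReal.mul
      (hasDerivAt_integral_eulerIntegrand hs t)
    convert! h2 using 1
    have h3 := integral_eulerIntegrand_succ hs t
    have h4 : (1 + t * Complex.I) ^ (s : ℂ)
        = (1 + t * Complex.I) ^ ((s : ℂ) - 1) * (1 + t * Complex.I) := by
      rw [Complex.cpow_sub _ _ (hne t), Complex.cpow_one, div_mul_cancel₀ _ (hne t)]
    rw [h4]
    linear_combination (Complex.I * (1 + t * Complex.I) ^ ((s : ℂ) - 1)) * h3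
  have hconst := is_const_of_deriv_eq_zero (fun t => (hd t).differentiableAt)
    (fun t => (hd t).deriv) t 0
  have h0 : ∫ x in Ioi 0, eulerIntegrand s 0 x = Real.Gamma s := by
    rw [Real.Gamma_eq_integral hs, ← integral_complex_ofReal]
    simp [eulerIntegrand]
  simp only [h0, Complex.ofReal_zero, zero_mul, add_zero, Complex.one_cpow, one_mul] at hconst
  rw [← hconst, Complex.cpow_neg]
  have : (1 + t * Complex.I) ^ (s : ℂ) ≠ 0 := by
    rw [Complex.cpow_def_of_ne_zero (hne t)]; exact Complex.exp_ne_zero _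
  field_simp

/-- Factor `1 + it = t (t⁻¹ + i)`: the limit is the real part of `i ^ (-s) = exp (-iπs/2)`, the
source of the cosine in the result. -/
theorem tendsto_rpow_mul_re_cpow_neg (s : ℝ) :
    Tendsto (fun t : ℝ => t ^ s * ((1 + t * Complex.I) ^ (-s : ℂ)).re) atTop
      (𝓝 (Real.cos (Real.pi * s / 2))) := by
  have hI : Complex.I ∈ Complex.slitPlane := by right; simp
  have h1 : Tendsto (fun t : ℝ => ((t⁻¹ : ℝ) : ℂ) + Complex.I) atTop (𝓝 Complex.I) := by
    have := ((Complex.continuous_ofReal.tendsto 0).comp tendsto_inv_atTop_zero).add_const Complex.I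
    simpa using this
  have h2 : Tendsto (fun t : ℝ => ((((t⁻¹ : ℝ) : ℂ) + Complex.I) ^ (-s : ℂ)).re) atTop
      (𝓝 (Complex.I ^ (-s : ℂ)).re) :=
    (Complex.continuous_re.tendsto _).comp
      ((continuousAt_cpow_const (b := (-s : ℂ)) hI).tendsto.comp h1)
  have h3 : (Complex.I ^ (-s : ℂ)).re = Real.cos (Real.pi * s / 2) := by
    rw [Complex.cpow_def_of_ne_zero Complex.I_ne_zero, Complex.log_I,
      show (Real.pi : ℂ) / 2 * Complex.I * -s = ((-(Real.pi * s / 2) : ℝ) : ℂ) * Complex.I by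
        push_cast; ring, Complex.exp_ofReal_mul_I_re, Real.cos_neg]
  rw [← h3]
  refine h2.congr' ?_
  filter_upwards [eventually_gt_atTop 0] with t ht
  have e : (1 + t * Complex.I) = (t : ℂ) * (((t⁻¹ : ℝ) : ℂ) + Complex.I) := by
    push_cast
    rw [mul_add, mul_inv_cancel₀ (by exact_mod_cast ht.ne')]
  have hmul : ((t : ℂ) * (((t⁻¹ : ℝ) : ℂ) + Complex.I)) ^ (-s : ℂ)
      = (t : ℂ) ^ (-s : ℂ) * (((t⁻¹ : ℝ) : ℂ) + Complex.I) ^ (-s : ℂ) := by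
    have h0 : ((t⁻¹ : ℝ) : ℂ) + Complex.I ≠ 0 := fun h => by
      simpa using congrArg Complex.im h
    have ht' : (t : ℂ) ≠ 0 := by exact_mod_cast ht.ne'
    rw [Complex.cpow_def_of_ne_zero (mul_ne_zero ht' h0), Complex.cpow_def_of_ne_zero ht',
      Complex.cpow_def_of_ne_zero h0, Complex.log_ofReal_mul ht h0, ← Complex.ofReal_log ht.le,
      add_mul, Complex.exp_add]
  rw [e, hmul, ← Complex.ofReal_neg, ← Complex.ofReal_cpow ht.le, Complex.re_ofReal_mul,
    ← mul_assoc, ← Real.rpow_add ht]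
  simp

theorem phase_image_Ioi : phase '' Ioi 0 = Ioi 0 := by
  apply Subset.antisymm
  · rintro _ ⟨x, hx, rfl⟩
    exact phase_pos hx
  · have := intermediate_value_Ioi (a := (0 : ℝ)) continuous_phase.continuousOn tendsto_phase
    rwa [phase_zero] at this

/-- Substitute `x = phase w`: the factor `phaseDeriv` in the model density is the Jacobian, and
`phase ^ ((β-1)/2) * exp (-phase)` is the Euler weight with `s = (β+1)/2`. -/
theorem integral_modelDensity_mul_osc {β : ℝ} (hβ : -1 < β) (t : ℝ) :
    ∫ w in Ioi 0, (modelDensity β w : ℂ) * osc t w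
      = ((4 ^ ((β + 1) / 2) / 2 * Real.Gamma ((β + 1) / 2) : ℝ) : ℂ)
        * (1 + t * Complex.I) ^ (-((β + 1) / 2 : ℝ) : ℂ) := by
  have h := integral_image_eq_integral_abs_deriv_smul (measurableSet_Ioi (a := (0 : ℝ)))
    (fun x _ => (hasDerivAt_phase x).hasDerivWithinAt)
    (phase_strictMonoOn.injOn.mono Ioi_subset_Ici_self) (eulerIntegrand ((β + 1) / 2) t)
  rw [phase_image_Ioi, integral_eulerIntegrand (by linarith)] at h
  have h4 : (4 : ℝ) ^ ((β + 1) / 2) / 2 = 2 * 4 ^ ((β - 1) / 2) := by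
    rw [show (β + 1) / 2 = (β - 1) / 2 + 1 by ring, Real.rpow_add_one (by norm_num)]
    ring
  rw [Complex.ofReal_mul, mul_assoc, h, ← integral_const_mul]
  refine setIntegral_congr_fun measurableSet_Ioi fun w hw => ?_
  rw [abs_of_pos (phaseDeriv_pos hw)]
  simp only [modelDensity, eulerIntegrand, osc, h4, Complex.real_smul]
  rw [show (β + 1) / 2 - 1 = (β - 1) / 2 by ring]
  push_cast
  ring

theorem tendsto_integral_modelDensity {β : ℝ} (hβ : -1 < β) :
    Tendsto (fun t : ℝ => t ^ ((β + 1) / 2) *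
        (∫ w in Ioi 0, (modelDensity β w : ℂ) * osc t w).re) atTop
      (𝓝 (4 ^ ((β + 1) / 2) / 2 * Real.Gamma ((β + 1) / 2)
        * Real.cos (Real.pi * (β + 1) / 4))) := by
  have h := (tendsto_rpow_mul_re_cpow_neg ((β + 1) / 2)).const_mul
    (4 ^ ((β + 1) / 2) / 2 * Real.Gamma ((β + 1) / 2))
  rw [show Real.pi * ((β + 1) / 2) / 2 = Real.pi * (β + 1) / 4 by ring] at h
  refine h.congr fun t => ?_
  rw [integral_modelDensity_mul_osc hβ, Complex.re_ofReal_mul]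
  ring

/-! ### From the regularity of the squared mode function to endpoint-regular amplitudes. -/

theorem contDiffOn_iteratedDeriv_Ioi {g : ℝ → ℝ} (hg : ContDiffOn ℝ ∞ g (Ioi 0)) (k : ℕ) :
    ContDiffOn ℝ ∞ (iteratedDeriv k g) (Ioi 0) := by
  induction k with
  | zero => simpa using hg
  | succ k ih =>
    rw [iteratedDeriv_succ]
    exact ih.deriv_of_isOpen isOpen_Ioi (by simp)

theorem hasDerivAt_iteratedDeriv_Ioi {g : ℝ → ℝ} (hg : ContDiffOn ℝ ∞ g (Ioi 0)) (k : ℕ) {w : ℝ}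
    (hw : 0 < w) : HasDerivAt (iteratedDeriv k g) (iteratedDeriv (k + 1) g w) w := by
  rw [iteratedDeriv_succ]
  exact (((contDiffOn_iteratedDeriv_Ioi hg k).contDiffAt (Ioi_mem_nhds hw)).differentiableAt
    (by simp)).hasDerivAt

theorem iteratedDeriv_sub_const_mul_Ioi {g h : ℝ → ℝ} (hg : ContDiffOn ℝ ∞ g (Ioi 0))
    (hh : ContDiffOn ℝ ∞ h (Ioi 0)) (B : ℝ) (k : ℕ) {w : ℝ} (hw : 0 < w) :
    iteratedDeriv k (fun w => g w - B * h w) w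
      = iteratedDeriv k g w - B * iteratedDeriv k h w := by
  have h1 : ContDiffAt ℝ k g w := (hg.contDiffAt (Ioi_mem_nhds hw)).of_le (mod_cast le_top)
  have h2 : ContDiffAt ℝ k h w := (hh.contDiffAt (Ioi_mem_nhds hw)).of_le (mod_cast le_top)
  have := iteratedDeriv_sub h1 (contDiffAt_const.mul h2 : ContDiffAt ℝ k (fun w => B * h w) w)
  rw [iteratedDeriv_const_mul_field] at this
  exact this

theorem contDiffOn_rpow_Ioi (p : ℝ) : ContDiffOn ℝ ∞ (fun w : ℝ => w ^ p) (Ioi 0) :=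
  contDiffOn_id.rpow_const_of_ne fun _ hw => ne_of_gt hw

theorem contDiffOn_modelDensity (β : ℝ) : ContDiffOn ℝ ∞ (modelDensity β) (Ioi 0) := by
  have h1 : ContDiff ℝ ∞ phase := by unfold phase; fun_prop
  have h2 : ContDiff ℝ ∞ phaseDeriv := by unfold phaseDeriv; fun_prop
  have h3 : ContDiffOn ℝ ∞ (fun w => phase w ^ ((β - 1) / 2)) (Ioi 0) :=
    h1.contDiffOn.rpow_const_of_ne fun _ hw => (phase_pos hw).ne'
  exact contDiffOn_const.mul (h3.mul (h1.neg.exp.mul h2).contDiffOn)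

/-- The germ estimate covers `(0, δ)`; compactness of `[δ, 1]` and continuity cover the rest. -/
theorem exists_bound_of_isBigO {F : ℝ → ℝ} {σ : ℝ} (hF : ContinuousOn F (Ioi 0))
    (h : F =O[𝓝[>] 0] fun w : ℝ => w ^ σ) :
    ∃ C, ∀ w, 0 < w → w ≤ 1 → |F w| ≤ C * w ^ σ := by
  obtain ⟨C, hC0, hC⟩ := h.exists_pos
  obtain ⟨δ, hδ, hδ'⟩ := mem_nhdsGT_iff_exists_Ioo_subset.1 hC.bound
  have hδ0 : (0 : ℝ) < δ := hδ
  have hcont : ContinuousOn (fun w => |F w / w ^ σ|) (Icc δ 1) := by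
    refine ContinuousOn.abs ((hF.mono fun w hw => hδ0.trans_le hw.1).div
      ((contDiffOn_rpow_Ioi σ).continuousOn.mono fun w hw => hδ0.trans_le hw.1) fun w hw => ?_)
    exact (Real.rpow_pos_of_pos (hδ0.trans_le hw.1) _).ne'
  obtain ⟨M, hM⟩ := isCompact_Icc.bddAbove_image hcont
  refine ⟨max C M, fun w h0 h1 => ?_⟩
  have hw : 0 < w ^ σ := Real.rpow_pos_of_pos h0 _
  rcases lt_or_ge w δ with hwδ | hwδ
  · have h2 : ‖F w‖ ≤ C * ‖w ^ σ‖ := hδ' ⟨h0, hwδ⟩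
    rw [Real.norm_of_nonneg hw.le] at h2
    exact h2.trans (mul_le_mul_of_nonneg_right (le_max_left _ _) hw.le)
  · have h2 : |F w / w ^ σ| ≤ M := hM (mem_image_of_mem _ ⟨hwδ, h1⟩)
    rw [abs_div, abs_of_pos hw, div_le_iff₀ hw] at h2
    exact h2.trans (mul_le_mul_of_nonneg_right (le_max_right _ _) hw.le)

theorem SymbolBound.exists_bound_of_le_one {α γ : ℝ} {F : ℝ → ℝ} (h : SymbolBound α γ F) :
    ∃ C, ∀ w, 0 < w → w ≤ 1 → |F w| ≤ C * w ^ α := by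
  obtain ⟨C, hC0, hC⟩ := (h.mono le_rfl (le_abs_self γ)).exists_pos
  refine ⟨C * Real.exp |γ|, fun w h0 h1 => (hC w h0).trans ?_⟩
  rw [symbolWeight_of_le_one h1, mul_assoc, mul_comm (w ^ α)]
  refine mul_le_mul_of_nonneg_left (mul_le_mul_of_nonneg_right (Real.exp_le_exp.2 ?_)
    (Real.rpow_nonneg h0.le _)) hC0.le
  exact mul_le_of_le_one_right (abs_nonneg _) h1

/-- The regularity assumptions on the squared mode function `g = |c|²`. -/
structure RegularDensity (B β : ℝ) (g : ℝ → ℝ) : Prop where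
  contDiffOn : ContDiffOn ℝ ∞ g (Ioi 0)
  integrable : ∀ k, IntegrableOn (iteratedDeriv k g) (Ioi 1)
  isBigO : ∀ k : ℕ, (iteratedDeriv k fun w => g w - B * w ^ β)
    =O[𝓝[>] 0] fun w : ℝ => w ^ (β + 2 - (k : ℝ))

theorem RegularDensity.exists_bound_sub {B β : ℝ} {g : ℝ → ℝ} (h : RegularDensity B β g) (k : ℕ) :
    ∃ C, ∀ w, 0 < w → w ≤ 1 → |iteratedDeriv k g w - B * iteratedDeriv k (fun w => w ^ β) w|
      ≤ C * w ^ (β + 2 - k) := by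
  have hr := contDiffOn_rpow_Ioi β
  have hs : ContDiffOn ℝ ∞ (fun w => g w - B * w ^ β) (Ioi 0) :=
    h.contDiffOn.sub (contDiffOn_const.mul hr)
  obtain ⟨C, hC⟩ := exists_bound_of_isBigO (contDiffOn_iteratedDeriv_Ioi hs k).continuousOn
    (h.isBigO k)
  refine ⟨C, fun w h0 h1 => ?_⟩
  rw [← iteratedDeriv_sub_const_mul_Ioi h.contDiffOn hr B k h0]
  exact hC w h0 h1

theorem abs_add_le_mul_rpow {x y C D σ σ' ρ w : ℝ} (h0 : 0 < w) (h1 : w ≤ 1)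
    (hσ : ρ ≤ σ) (hσ' : ρ ≤ σ') (hx : |x| ≤ C * w ^ σ) (hy : |y| ≤ D * w ^ σ') :
    |x + y| ≤ (|C| + |D|) * w ^ ρ := by
  have e1 : w ^ σ ≤ w ^ ρ := Real.rpow_le_rpow_of_exponent_ge h0 h1 hσ
  have e2 : w ^ σ' ≤ w ^ ρ := Real.rpow_le_rpow_of_exponent_ge h0 h1 hσ'
  rw [add_mul]
  refine (abs_add_le _ _).trans (add_le_add (hx.trans ?_) (hy.trans ?_))
  · exact mul_le_mul (le_abs_self C) e1 (Real.rpow_nonneg h0.le _) (abs_nonneg _)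
  · exact mul_le_mul (le_abs_self D) e2 (Real.rpow_nonneg h0.le _) (abs_nonneg _)

theorem RegularDensity.endpointRegular {B β : ℝ} {g : ℝ → ℝ} (h : RegularDensity B β g) :
    EndpointRegular β (fun k => iteratedDeriv k g) where
  hasDerivAt k w hw := hasDerivAt_iteratedDeriv_Ioi h.contDiffOn k hw
  integrable := h.integrable
  bound k := by
    obtain ⟨C, hC⟩ := h.exists_bound_sub k
    obtain ⟨D, hD⟩ := ((isSymbol_rpow k β).iteratedDeriv_bound).exists_bound_of_le_one
    refine ⟨|C| + |(|B| * D)|, fun w h0 h1 => ?_⟩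
    have hD' : |B * iteratedDeriv k (fun w => w ^ β) w| ≤ |B| * D * w ^ (β - k) := by
      rw [abs_mul, mul_assoc]
      exact mul_le_mul_of_nonneg_left (hD w h0 h1) (abs_nonneg _)
    simpa using abs_add_le_mul_rpow (ρ := β - k) h0 h1 (by linarith) le_rfl (hC w h0 h1) hD'

/-- The expansion of `g` leaves a remainder of order `β + 2`, and replacing `w ^ β` by the model
density leaves one of order `β + 1`. This gain over `β` makes the difference negligible. -/
theorem RegularDensity.endpointRegular_sub {B β : ℝ} {g : ℝ → ℝ} (h : RegularDensity B β g) :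
    EndpointRegular (β + 1)
      (fun k w => iteratedDeriv k g w - B * iteratedDeriv k (modelDensity β) w) where
  hasDerivAt k w hw := (hasDerivAt_iteratedDeriv_Ioi h.contDiffOn k hw).sub
    ((hasDerivAt_iteratedDeriv_Ioi (contDiffOn_modelDensity β) k hw).const_mul B)
  integrable k := by
    refine (h.integrable k).sub (Integrable.const_mul ?_ B)
    obtain ⟨C, hC⟩ := (isSymbol_modelDensity k β).iteratedDeriv_bound
    refine ((integrableOn_exp_mul_Ioi (a := -(3 / 4)) (by norm_num) 1).const_mul C).mono'
      (((contDiffOn_iteratedDeriv_Ioi (contDiffOn_modelDensity β) k).continuousOn.mono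
        (Ioi_subset_Ioi zero_le_one)).aestronglyMeasurable measurableSet_Ioi) ?_
    filter_upwards [ae_restrict_mem measurableSet_Ioi] with w hw
    have := hC w (zero_lt_one.trans hw)
    rwa [symbolWeight_of_one_le (le_of_lt hw)] at this
  bound k := by
    obtain ⟨C, hC⟩ := h.exists_bound_sub k
    obtain ⟨D, hD⟩ := ((isSymbol_modelDensity_sub k β).iteratedDeriv_bound).exists_bound_of_le_one
    refine ⟨|C| + |(|B| * D)|, fun w h0 h1 => ?_⟩
    have e := iteratedDeriv_sub_const_mul_Ioi (contDiffOn_modelDensity β) (contDiffOn_rpow_Ioi β)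
      1 k h0
    simp only [one_mul] at e
    have hD' : |-(B * iteratedDeriv k (fun w => modelDensity β w - w ^ β) w)|
        ≤ |B| * D * w ^ (β + 1 - k) := by
      rw [abs_neg, abs_mul, mul_assoc]
      exact mul_le_mul_of_nonneg_left (hD w h0 h1) (abs_nonneg _)
    have := abs_add_le_mul_rpow (ρ := β + 1 - k) h0 h1 (by linarith) le_rfl (hC w h0 h1) hD'
    rw [e] at this
    convert! this using 2
    ring

theorem RegularDensity.integrableOn {B β : ℝ} {g : ℝ → ℝ} (h : RegularDensity B β g)
    (hβ : -1 < β) : IntegrableOn g (Ioi 0) := by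
  have := h.endpointRegular.integrableOn_mul 0 (c := fun _ => 1) (D := 1) (a := 0)
    continuousOn_const (fun w _ => by simp) (by simpa using hβ)
  simpa using this

/-! ### The one-mode integral. -/

/-- The one-mode oscillatory integral with shifted phase. -/
noncomputable def modeIntegral (g : ℝ → ℝ) (t y : ℝ) : ℂ := ∫ w in Ioi 0, (g w : ℂ) * osc t (w + y)

theorem RegularDensity.exists_norm_modeIntegral_shift_le {B β : ℝ} {g : ℝ → ℝ}
    (h : RegularDensity B β g) (K : ℕ) (hK : (K : ℝ) < β + 1) :
    ∃ C, ∀ y t, 0 < y → 0 < t →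
      ‖modeIntegral g t y‖ ≤ C * (t⁻¹ ^ K * min y 1 ^ (-(K : ℝ))) := by
  have hK0 : (0 : ℝ) ≤ K := K.cast_nonneg
  have := h.endpointRegular.exists_norm_integral_shift_le K 0 0 K (fun _ => 1)
    (by simpa using isSymbol_const K 1) le_rfl hK0 (by push_cast; linarith) (by push_cast; linarith)
  simpa [modeIntegral] using this

theorem RegularDensity.tendsto_modeIntegral_zero {B β : ℝ} {g : ℝ → ℝ}
    (h : RegularDensity B β g) (hβ : -1 < β) :
    Tendsto (fun t : ℝ => t ^ ((β + 1) / 2) * (modeIntegral g t 0).re) atTop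
      (𝓝 (B * (4 ^ ((β + 1) / 2) / 2 * Real.Gamma ((β + 1) / 2)
        * Real.cos (Real.pi * (β + 1) / 4)))) := by
  set f : ℕ → ℝ → ℝ := fun k w => iteratedDeriv k g w - B * iteratedDeriv k (modelDensity β) w
    with hf
  set j := ⌊(β + 1) / 2⌋₊ with hj
  have hj1 : (j : ℝ) ≤ (β + 1) / 2 := Nat.floor_le (by linarith)
  have hj2 : (β + 1) / 2 < j + 1 := Nat.lt_floor_add_one _
  -- With order `β + 1` itself, `β + 1 - 2j` could reach `1` or more, outside the range of the decay
  -- estimate. The order is lowered, if necessary, to the midpoint of `β` and `2j + 1`, which still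
  -- exceeds `β`.
  obtain ⟨α, hα1, hα2, hα3, hα4⟩ : ∃ α, β < α ∧ α ≤ β + 1 ∧ -1 < α - 2 * j ∧ α - 2 * j < 1 := by
    refine ⟨min (β + 1) ((β + 2 * j + 1) / 2), lt_min (by linarith) (by linarith),
      min_le_left _ _, ?_, ?_⟩
    · have : 2 * (j : ℝ) - 1 < min (β + 1) ((β + 2 * j + 1) / 2) :=
        lt_min (by linarith) (by linarith)
      linarith
    · linarith [min_le_right (β + 1) ((β + 2 * (j : ℝ) + 1) / 2)]
  obtain ⟨C, hC⟩ := (h.endpointRegular_sub.mono hα2).exists_norm_integral_le j 0 0 (fun _ => 1)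
    (by simpa using isSymbol_const (j + 1) 1) (by simpa using hα3) (by simpa using hα4)
  simp only [mul_one, add_zero, Nat.cast_zero, sub_zero, iteratedDeriv_zero] at hC
  have hmi : IntegrableOn (modelDensity β) (Ioi 0) := by
    obtain ⟨D, hD⟩ := (isSymbol_modelDensity 0 β).bound.exists_bound_of_le_one
    obtain ⟨D', hD'⟩ := (isSymbol_modelDensity 0 β).bound
    refine integrableOn_Ioi_of_bound (contDiffOn_modelDensity β).continuousOn hD hβ ?_
    refine ((integrableOn_exp_mul_Ioi (a := -(3 / 4)) (by norm_num) 1).const_mul D').mono'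
      (((contDiffOn_modelDensity β).continuousOn.mono
        (Ioi_subset_Ioi zero_le_one)).aestronglyMeasurable measurableSet_Ioi) ?_
    filter_upwards [ae_restrict_mem measurableSet_Ioi] with w hw
    have := hD' w (zero_lt_one.trans hw)
    rwa [symbolWeight_of_one_le (le_of_lt hw)] at this
  have hdecomp : ∀ t : ℝ, modeIntegral g t 0
      = (∫ w in Ioi 0, ((g w - B * modelDensity β w : ℝ) : ℂ) * osc t w)
        + (B : ℂ) * ∫ w in Ioi 0, (modelDensity β w : ℂ) * osc t w := by
    intro t
    have h1 := integrableOn_mul_osc ((h.integrableOn hβ).sub (hmi.const_mul B)) t 0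
    have h2 := (integrableOn_mul_osc hmi t 0).const_mul (B : ℂ)
    simp only [add_zero] at h1 h2
    rw [← integral_const_mul, modeIntegral]
    refine Eq.trans ?_ (integral_add h1 h2)
    refine integral_congr_ae (Eventually.of_forall fun w => ?_)
    simp only [add_zero]
    push_cast
    ring
  have hrem : Tendsto (fun t : ℝ => t ^ ((β + 1) / 2) *
      (∫ w in Ioi 0, ((g w - B * modelDensity β w : ℝ) : ℂ) * osc t w).re) atTop (𝓝 0) := by
    have h0 : Tendsto (fun t : ℝ => C * t ^ (-((α - β) / 2))) atTop (𝓝 0) := by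
      simpa using (tendsto_rpow_neg_atTop (by linarith : 0 < (α - β) / 2)).const_mul C
    refine squeeze_zero_norm' ?_ h0
    filter_upwards [eventually_ge_atTop 1] with t ht
    have ht0 : 0 < t := by linarith
    rw [norm_mul, Real.norm_of_nonneg (Real.rpow_nonneg ht0.le _)]
    calc _ ≤ t ^ ((β + 1) / 2) * (C * t ^ (-((α + 1) / 2))) :=
          mul_le_mul_of_nonneg_left ((Complex.abs_re_le_norm _).trans (hC t ht))
            (Real.rpow_nonneg ht0.le _)
      _ = C * (t ^ ((β + 1) / 2) * t ^ (-((α + 1) / 2))) := by ring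
      _ = _ := by rw [← Real.rpow_add ht0]; ring_nf
  have hsum := hrem.add ((tendsto_integral_modelDensity hβ).const_mul B)
  rw [zero_add] at hsum
  refine hsum.congr fun t => ?_
  rw [hdecomp, Complex.add_re, Complex.re_ofReal_mul]
  ring

/-! ### Matrix elements on the particle sectors. -/

/-- The matrix element of `cos (t (E(H₀) - H₀))` in the `n`-particle component. -/
noncomputable def cosElement (C : OneParticle) (n : ℕ) (t : ℝ) : ℝ :=
  (inner ℂ (tensorPower n C) (cosEvolution n t (tensorPower n C))).re

theorem coeFn_tensorPower {C : OneParticle} {c : ℝ → ℂ} (hc : C =ᵐ[modeMeasure] c) (n : ℕ) :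
    tensorPower n C =ᵐ[modesMeasure n] fun w => ∏ j, c (w j) := by
  have h1 : tensorPower n C =ᵐ[modesMeasure n] fun w => ∏ j, C (w j) :=
    MemLp.coeFn_toLp (memLp_tensor (Lp.memLp C) n)
  have h2 : ∀ᵐ w ∂modesMeasure n, ∀ j, C (w j) = c (w j) := by
    rw [ae_all_iff]
    exact fun j => (Measure.quasiMeasurePreserving_eval (fun _ : Fin n => modeMeasure) j).ae hc
  filter_upwards [h1, h2] with w hw1 hw2
  rw [hw1]
  exact Finset.prod_congr rfl fun j _ => hw2 j

theorem coeFn_cosEvolution (n : ℕ) (t : ℝ) (ψ : NParticle n) :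
    cosEvolution n t ψ =ᵐ[modesMeasure n]
      fun w => (Real.cos (t * (energy (∑ j, w j) - ∑ j, w j)) : ℂ) * ψ w :=
  MemLp.coeFn_toLp (mem_domain_cos n t ψ)

theorem osc_re (t x : ℝ) : (osc t x).re = Real.cos (t * (energy x - x)) := by
  rw [osc, Complex.exp_ofReal_mul_I_re, phase, energy]
  ring_nf

theorem cosElement_eq {C : OneParticle} {c : ℝ → ℂ} (hc : C =ᵐ[modeMeasure] c) (n : ℕ) (t : ℝ)
    (hg : Integrable (fun w => ‖c w‖ ^ 2) modeMeasure) :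
    cosElement C n t = (∫ w : Fin n → ℝ, ((∏ j, ‖c (w j)‖ ^ 2 : ℝ) : ℂ) * osc t (∑ j, w j)
      ∂modesMeasure n).re := by
  have hint : Integrable (fun w : Fin n → ℝ => ((∏ j, ‖c (w j)‖ ^ 2 : ℝ) : ℂ) * osc t (∑ j, w j))
      (modesMeasure n) := by
    have h3 : Integrable (fun w : Fin n → ℝ => ∏ j, ‖c (w j)‖ ^ 2) (modesMeasure n) :=
      Integrable.fintype_prod (f := fun _ : Fin n => fun w => ‖c w‖ ^ 2) fun _ => hg
    refine Integrable.mul_bdd (c := 1) h3.ofReal ?_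
      (Eventually.of_forall fun w => (norm_osc _ _).le)
    exact ((continuous_osc t).comp (by fun_prop)).aestronglyMeasurable
  have hinner : Integrable (fun w => inner ℂ (tensorPower n C w)
      (cosEvolution n t (tensorPower n C) w)) (modesMeasure n) := L2.integrable_inner _ _
  rw [cosElement, L2.inner_def, ← RCLike.re_eq_complex_re, ← integral_re hinner,
    ← integral_re hint]
  refine integral_congr_ae ?_
  filter_upwards [coeFn_tensorPower hc n, coeFn_cosEvolution n t (tensorPower n C)] with w h1 h2
  rw [h2, h1, RCLike.re_eq_complex_re, Complex.re_ofReal_mul, osc_re]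
  have e : inner ℂ (∏ j, c (w j)) ((Real.cos (t * (energy (∑ j, w j) - ∑ j, w j)) : ℂ)
      * ∏ j, c (w j)) = ((‖∏ j, c (w j)‖ ^ 2 *
        Real.cos (t * (energy (∑ j, w j) - ∑ j, w j)) : ℝ) : ℂ) := by
    rw [RCLike.inner_apply, mul_assoc, Complex.mul_conj, Complex.normSq_eq_norm_sq]
    push_cast
    ring
  rw [e, Complex.ofReal_re, norm_prod, Finset.prod_pow]

theorem cosElement_zero (C : OneParticle) (t : ℝ) : cosElement C 0 t = 1 := by
  have hg : Integrable (fun w => ‖C w‖ ^ 2) modeMeasure :=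
    (memLp_two_iff_integrable_sq_norm (Lp.memLp C).aestronglyMeasurable).1 (Lp.memLp C)
  rw [cosElement_eq (c := C) (Eventually.of_forall fun _ => rfl) 0 t hg, modesMeasure,
    Measure.pi_of_empty]
  simp [osc, phase_zero]

instance (n : ℕ) : SigmaFinite (modesMeasure n) := by
  unfold modesMeasure
  infer_instance

/-- Fubini in the first mode: the total energy of the other modes becomes the shift of the phase. -/
theorem integral_modesMeasure_succ (g : ℝ → ℝ) (hg : Integrable g modeMeasure) (n : ℕ) (t : ℝ) :
    ∫ w : Fin (n + 1) → ℝ, ((∏ j, g (w j) : ℝ) : ℂ) * osc t (∑ j, w j) ∂modesMeasure (n + 1)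
      = ∫ v : Fin n → ℝ, ((∏ j, g (v j) : ℝ) : ℂ) * modeIntegral g t (∑ j, v j)
        ∂modesMeasure n := by
  have hmp := (measurePreserving_piFinSuccAbove (fun _ : Fin (n + 1) => modeMeasure) 0).symm
  have h3 : Integrable (fun v : Fin n → ℝ => ∏ j, g (v j)) (modesMeasure n) :=
    Integrable.fintype_prod (f := fun _ : Fin n => g) fun _ => hg
  have hprod : Integrable (fun z : ℝ × (Fin n → ℝ) => ((g z.1 * ∏ j, g (z.2 j) : ℝ) : ℂ)
      * osc t (z.1 + ∑ j, z.2 j)) (modeMeasure.prod (modesMeasure n)) := by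
    refine Integrable.mul_bdd (c := 1) (hg.mul_prod h3).ofReal ?_
      (Eventually.of_forall fun w => (norm_osc _ _).le)
    exact ((continuous_osc t).comp (by fun_prop)).aestronglyMeasurable
  have hcomp := hmp.integral_comp' (g := fun w : Fin (n + 1) → ℝ =>
    ((∏ j, g (w j) : ℝ) : ℂ) * osc t (∑ j, w j))
  rw [modesMeasure, ← hcomp]
  have e : ∀ z : ℝ × (Fin n → ℝ), (MeasurableEquiv.piFinSuccAbove (fun _ : Fin (n + 1) => ℝ) 0).symm z
      = Fin.cons z.1 z.2 := fun z => by
    ext i; refine Fin.cases ?_ (fun i => ?_) i <;> simp [MeasurableEquiv.piFinSuccAbove]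
  simp only [e, Fin.prod_univ_succ, Fin.sum_univ_succ, Fin.cons_zero, Fin.cons_succ]
  refine (integral_prod_symm _ hprod).trans ?_
  refine integral_congr_ae (Eventually.of_forall fun v => ?_)
  simp only [modeIntegral]
  rw [← integral_const_mul]
  refine integral_congr_ae (Eventually.of_forall fun w => ?_)
  simp only
  push_cast
  ring

theorem ae_modesMeasure_pos (n : ℕ) : ∀ᵐ w ∂modesMeasure n, ∀ j, 0 < w j := by
  rw [ae_all_iff]
  exact fun j => (Measure.quasiMeasurePreserving_eval (fun _ : Fin n => modeMeasure) j).ae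
    (ae_restrict_mem measurableSet_Ioi)

/-- The sum of the frozen modes is at least `v 0`, so its singularity of order `K` is charged to
that mode alone; it is integrable there because `β - K > -1`. -/
theorem exists_norm_integral_modesMeasure_le {B β : ℝ} {g : ℝ → ℝ} (h : RegularDensity B β g)
    (hg0 : ∀ w, 0 ≤ g w) (n K : ℕ) (hK : (K : ℝ) < β + 1) :
    ∃ C, ∀ t, 0 < t → ‖∫ v : Fin (n + 1) → ℝ, ((∏ j, g (v j) : ℝ) : ℂ) *
      modeIntegral g t (∑ j, v j) ∂modesMeasure (n + 1)‖ ≤ C * t⁻¹ ^ K := by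
  have hK0 : (0 : ℝ) ≤ K := K.cast_nonneg
  obtain ⟨C, hC⟩ := h.exists_norm_modeIntegral_shift_le K hK
  have hgi : Integrable g modeMeasure := h.integrableOn (by linarith)
  have hgm : Integrable (fun w => g w * min w 1 ^ (-(K : ℝ))) modeMeasure := by
    have := h.endpointRegular.integrableOn_mul 0 (c := fun w => min w 1 ^ (-(K : ℝ))) (D := 1)
      (a := K) ((by fun_prop : ContinuousOn (fun w : ℝ => min w 1) (Ioi 0)).rpow_const
        fun w hw => Or.inl (lt_min hw one_pos).ne')
      (fun w hw => by
        rw [one_mul, abs_of_nonneg (Real.rpow_nonneg (lt_min hw one_pos).le _)])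
      (by push_cast; linarith)
    simpa [modeMeasure, IntegrableOn] using this
  have hint : Integrable (fun v : Fin (n + 1) → ℝ =>
      (∏ j, g (v j)) * min (v 0) 1 ^ (-(K : ℝ))) (modesMeasure (n + 1)) := by
    have := Integrable.fintype_prod (μ := fun _ : Fin (n + 1) => modeMeasure)
      (f := Fin.cons (fun w => g w * min w 1 ^ (-(K : ℝ))) fun _ : Fin n => g)
      (Fin.cases hgm fun _ => hgi)
    refine this.congr (Eventually.of_forall fun v => ?_)
    simp only [Fin.prod_univ_succ, Fin.cons_zero, Fin.cons_succ]
    ring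
  refine ⟨|C| * ∫ v : Fin (n + 1) → ℝ, (∏ j, g (v j)) * min (v 0) 1 ^ (-(K : ℝ))
    ∂modesMeasure (n + 1), fun t ht => ?_⟩
  refine (norm_integral_le_integral_norm _).trans ?_
  rw [mul_right_comm, ← integral_const_mul]
  refine integral_mono_of_nonneg (Eventually.of_forall fun v => norm_nonneg _)
    (hint.const_mul _) ?_
  filter_upwards [ae_modesMeasure_pos (n + 1)] with v hv
  have hle : v 0 ≤ ∑ j, v j := Finset.single_le_sum (fun j _ => (hv j).le) (Finset.mem_univ 0)
  have hp : 0 ≤ ∏ j, g (v j) := Finset.prod_nonneg fun j _ => hg0 _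
  have hpow : min (∑ j, v j) 1 ^ (-(K : ℝ)) ≤ min (v 0) 1 ^ (-(K : ℝ)) :=
    Real.rpow_le_rpow_of_nonpos (lt_min (hv 0) one_pos) (min_le_min_right _ hle) (by linarith)
  have hsum : 0 < ∑ j, v j := (hv 0).trans_le hle
  rw [norm_mul, Complex.norm_real, Real.norm_of_nonneg hp]
  have h1 : ‖modeIntegral g t (∑ j, v j)‖ ≤ |C| * (t⁻¹ ^ K * min (v 0) 1 ^ (-(K : ℝ))) := by
    refine (hC _ t hsum ht).trans ?_
    have : 0 ≤ min (∑ j, v j) 1 ^ (-(K : ℝ)) := Real.rpow_nonneg (lt_min hsum one_pos).le _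
    exact mul_le_mul (le_abs_self C) (mul_le_mul_of_nonneg_left hpow (by positivity))
      (by positivity) (abs_nonneg C)
  calc _ ≤ (∏ j, g (v j)) * (|C| * (t⁻¹ ^ K * min (v 0) 1 ^ (-(K : ℝ)))) :=
        mul_le_mul_of_nonneg_left h1 hp
    _ = _ := by ring

/-- With a single mode there is nothing left to freeze: the shift is an empty sum, and the
stationary case applies. -/
theorem tendsto_cosElement_one {C : OneParticle} {c : ℝ → ℂ} (hc : C =ᵐ[modeMeasure] c)
    {B β : ℝ} (h : RegularDensity B β fun w => ‖c w‖ ^ 2) (hβ : -1 < β) :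
    Tendsto (fun t : ℝ => t ^ ((β + 1) / 2) * cosElement C 1 t) atTop
      (𝓝 (B * (4 ^ ((β + 1) / 2) / 2 * Real.Gamma ((β + 1) / 2)
        * Real.cos (Real.pi * (β + 1) / 4)))) := by
  have hg : Integrable (fun w => ‖c w‖ ^ 2) modeMeasure := h.integrableOn hβ
  refine (h.tendsto_modeIntegral_zero hβ).congr fun t => ?_
  rw [cosElement_eq hc 1 t hg, integral_modesMeasure_succ (fun w => ‖c w‖ ^ 2) hg 0 t,
    modesMeasure, Measure.pi_of_empty]
  simp

theorem tendsto_cosElement_add_two {C : OneParticle} {c : ℝ → ℂ} (hc : C =ᵐ[modeMeasure] c)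
    {B β : ℝ} (h : RegularDensity B β fun w => ‖c w‖ ^ 2) (hβ : 1 < β) (n : ℕ) :
    Tendsto (fun t : ℝ => t ^ ((β + 1) / 2) * cosElement C (n + 2) t) atTop (𝓝 0) := by
  have hg : Integrable (fun w => ‖c w‖ ^ 2) modeMeasure := h.integrableOn (by linarith)
  -- The least integer above `(β + 1) / 2`. It stays below `β + 1` exactly because `β > 1`, as it is
  -- at most `(β + 1) / 2 + 1`.
  set K := ⌊(β + 1) / 2⌋₊ + 1 with hK
  have hK1 : (β + 1) / 2 < K := by rw [hK]; exact_mod_cast Nat.lt_floor_add_one _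
  have hK2 : (K : ℝ) < β + 1 := by
    have : (⌊(β + 1) / 2⌋₊ : ℝ) ≤ (β + 1) / 2 := Nat.floor_le (by linarith)
    rw [hK]; push_cast; linarith
  obtain ⟨D, hD⟩ := exists_norm_integral_modesMeasure_le h (fun w => by positivity) n K hK2
  have h0 : Tendsto (fun t : ℝ => D * t ^ (-(K - (β + 1) / 2))) atTop (𝓝 0) := by
    simpa using (tendsto_rpow_neg_atTop (by linarith : 0 < K - (β + 1) / 2)).const_mul D
  refine squeeze_zero_norm' ?_ h0
  filter_upwards [eventually_gt_atTop 0] with t ht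
  rw [norm_mul, Real.norm_of_nonneg (Real.rpow_nonneg ht.le _), cosElement_eq hc (n + 2) t hg,
    integral_modesMeasure_succ (fun w => ‖c w‖ ^ 2) hg (n + 1) t]
  calc _ ≤ t ^ ((β + 1) / 2) * (D * t⁻¹ ^ K) :=
        mul_le_mul_of_nonneg_left ((Complex.abs_re_le_norm _).trans (hD t ht))
          (Real.rpow_nonneg ht.le _)
    _ = D * (t ^ ((β + 1) / 2) * t ^ (-(K : ℝ))) := by
        rw [Real.rpow_neg ht.le, Real.rpow_natCast, inv_pow]; ring
    _ = _ := by rw [← Real.rpow_add ht]; ring_nf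

/-! ### Assembly of the truncated sum. -/

theorem isLittleO_rpow_neg_of_tendsto {F : ℝ → ℝ} {s : ℝ}
    (h : Tendsto (fun t : ℝ => t ^ s * F t) atTop (𝓝 0)) :
    F =o[atTop] fun t : ℝ => t ^ (-s) := by
  refine (isLittleO_iff_tendsto' ?_).2 (h.congr' ?_)
  · filter_upwards [eventually_gt_atTop 0] with t ht h0
    exact absurd h0 (Real.rpow_pos_of_pos ht _).ne'
  · filter_upwards [eventually_gt_atTop 0] with t ht
    rw [Real.rpow_neg ht.le, div_inv_eq_mul, mul_comm]

theorem truncatedSqDist_eq (C : OneParticle) (t : ℝ) (N : ℕ) :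
    truncatedSqDist C t (N + 1) = 2 - 2 * Real.exp (-‖C‖ ^ 2) * (1 + (cosElement C 1 t +
      ∑ n ∈ Finset.range N, (1 / ((n + 2).factorial : ℝ)) * cosElement C (n + 2) t)) := by
  have e : truncatedSqDist C t (N + 1) = 2 - 2 * Real.exp (-‖C‖ ^ 2) *
      ∑ n ∈ Finset.range (N + 2), (1 / (n.factorial : ℝ)) * cosElement C n t := rfl
  rw [e, Finset.sum_range_succ', Finset.sum_range_succ', cosElement_zero]
  simp
  ring

theorem isLittleO_truncatedSqDist {C : OneParticle} {c : ℝ → ℂ} (hc : C =ᵐ[modeMeasure] c)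
    {B β : ℝ} (h : RegularDensity B β fun w => ‖c w‖ ^ 2) (hβ : 1 < β) (N : ℕ) :
    (fun t : ℝ => truncatedSqDist C t (N + 1)
        - (2 - 2 * Real.exp (-‖C‖ ^ 2)
            - B * Real.exp (-‖C‖ ^ 2) * Real.Gamma ((β + 1) / 2)
              * Real.cos (Real.pi * (β + 1) / 4) * (4 / t) ^ ((β + 1) / 2)))
      =o[atTop] fun t : ℝ => t ^ (-((β + 1) / 2)) := by
  apply isLittleO_rpow_neg_of_tendsto
  set s := (β + 1) / 2 with hs
  set L := B * (4 ^ s / 2 * Real.Gamma s * Real.cos (Real.pi * (β + 1) / 4)) with hL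
  have h1 : Tendsto (fun t : ℝ => t ^ s * cosElement C 1 t - L) atTop (𝓝 0) := by
    have := (tendsto_cosElement_one hc h (by linarith)).sub_const L
    rwa [← hs, ← hL, sub_self] at this
  have h2 : Tendsto (fun t : ℝ => ∑ n ∈ Finset.range N, (1 / ((n + 2).factorial : ℝ)) *
      (t ^ s * cosElement C (n + 2) t)) atTop (𝓝 0) := by
    have := tendsto_finsetSum (Finset.range N) fun n _ =>
      (tendsto_cosElement_add_two hc h hβ n).const_mul (1 / ((n + 2).factorial : ℝ))
    simpa only [mul_zero, Finset.sum_const_zero] using this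
  -- The prefactor `2` of the sum cancels the `1/2` in `L`, which comes from the model integral.
  have h3 := (h1.add h2).const_mul (-2 * Real.exp (-‖C‖ ^ 2))
  rw [add_zero, mul_zero] at h3
  refine h3.congr' ?_
  filter_upwards [eventually_gt_atTop 0] with t ht
  have e1 : ∑ n ∈ Finset.range N, (1 / ((n + 2).factorial : ℝ)) * (t ^ s * cosElement C (n + 2) t)
      = t ^ s * ∑ n ∈ Finset.range N, (1 / ((n + 2).factorial : ℝ)) * cosElement C (n + 2) t := by
    rw [Finset.mul_sum]
    exact Finset.sum_congr rfl fun n _ => by ring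
  have e2 : t ^ s * (4 / t) ^ s = 4 ^ s := by
    rw [← Real.mul_rpow ht.le (by positivity), mul_div_cancel₀ _ ht.ne']
  rw [truncatedSqDist_eq, e1, hL]
  linear_combination (-B * Real.exp (-‖C‖ ^ 2) * Real.Gamma s
    * Real.cos (Real.pi * (β + 1) / 4)) * e2

theorem isBigO_of_isLittleO_sub_rpow {F : ℝ → ℝ} {a A s r : ℝ} (hr : r ≤ s)
    (h : (fun t : ℝ => F t - (a - A * (4 / t) ^ s)) =o[atTop] fun t : ℝ => t ^ (-s)) :
    (fun t : ℝ => F t - a) =O[atTop] fun t : ℝ => t ^ (-r) := by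
  have h1 : (fun t : ℝ => A * (4 / t) ^ s) =O[atTop] fun t : ℝ => t ^ (-s) := by
    refine IsBigO.of_bound (|A| * 4 ^ s) ?_
    filter_upwards [eventually_gt_atTop 0] with t ht
    rw [Real.div_rpow (by norm_num) ht.le, Real.rpow_neg ht.le, norm_mul, norm_div, norm_inv,
      Real.norm_eq_abs A, Real.norm_of_nonneg (by positivity : (0 : ℝ) ≤ 4 ^ s), div_eq_mul_inv,
      mul_assoc]
  have h2 : (fun t : ℝ => t ^ (-s)) =O[atTop] fun t : ℝ => t ^ (-r) := by
    refine IsBigO.of_bound 1 ?_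
    filter_upwards [eventually_ge_atTop 1] with t ht
    have ht0 : 0 < t := by linarith
    rw [one_mul, Real.norm_of_nonneg (Real.rpow_nonneg ht0.le _),
      Real.norm_of_nonneg (Real.rpow_nonneg ht0.le _)]
    exact Real.rpow_le_rpow_of_exponent_le ht (by linarith)
  refine IsBigO.trans ?_ h2
  refine (h.isBigO.sub h1).congr_left fun t => ?_
  ring

end EinsteinRosen

theorem proposition2 (C : EinsteinRosen.OneParticle) (c : ℝ → ℂ)
    (hc : C =ᵐ[EinsteinRosen.modeMeasure] c)
    (B β : ℝ) (hB : B ≠ 0) (hβ : 2 ≤ β)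
    -- the behaviour of the mode function at small `w`
    (hexp : (fun w : ℝ => ‖c w‖ ^ 2 - B * w ^ β) =O[𝓝[>] 0] fun w : ℝ => w ^ (β + 2))
    -- regularity: `|c|²` is smooth, its derivatives are integrable at infinity, and the expansion
    -- at `0` may be differentiated term by term
    (hsmooth : ContDiffOn ℝ ∞ (fun w : ℝ => ‖c w‖ ^ 2) (Ioi 0))
    (hdecay : ∀ k : ℕ, 1 ≤ k →
      IntegrableOn (iteratedDeriv k fun w : ℝ => ‖c w‖ ^ 2) (Ioi 1))
    (hderiv : ∀ k : ℕ, 1 ≤ k →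
      (iteratedDeriv k fun w : ℝ => ‖c w‖ ^ 2 - B * w ^ β)
        =O[𝓝[>] 0] fun w : ℝ => w ^ (β + 2 - (k : ℝ)))
    (N : ℕ) (hN : 1 ≤ N) :
    ((fun t : ℝ => EinsteinRosen.truncatedSqDist C t N
        - (2 - 2 * Real.exp (-‖C‖ ^ 2)
            - B * Real.exp (-‖C‖ ^ 2) * Real.Gamma ((β + 1) / 2)
              * Real.cos (Real.pi * (β + 1) / 4) * (4 / t) ^ ((β + 1) / 2)))
      =o[atTop] fun t : ℝ => t ^ (-((β + 1) / 2))) ∧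
    ((fun t : ℝ => EinsteinRosen.truncatedSqDist C t N - (2 - 2 * Real.exp (-‖C‖ ^ 2)))
      =O[atTop] fun t : ℝ => t ^ (-(3 / 2 : ℝ))) := by
  have hg : Integrable (fun w => ‖c w‖ ^ 2) EinsteinRosen.modeMeasure := by
    refine ((memLp_two_iff_integrable_sq_norm (Lp.memLp C).aestronglyMeasurable).1
      (Lp.memLp C)).congr ?_
    filter_upwards [hc] with w hw
    rw [hw]
  have hreg : EinsteinRosen.RegularDensity B β fun w => ‖c w‖ ^ 2 :=
    { contDiffOn := hsmooth
      integrable := fun k => by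
        -- Integrability of `|c|²` itself is not among the regularity assumptions; it follows from
        -- `C` being in `L²`.
        rcases Nat.eq_zero_or_pos k with rfl | hk
        · rw [iteratedDeriv_zero]
          exact IntegrableOn.mono_set hg (Ioi_subset_Ioi zero_le_one)
        · exact hdecay k hk
      isBigO := fun k => by
        rcases Nat.eq_zero_or_pos k with rfl | hk
        · simpa using hexp
        · exact hderiv k hk }
  -- `N ≥ 1` guarantees that the one-particle term, the source of the leading correction, is in the
  -- sum.
  obtain ⟨M, rfl⟩ := Nat.exists_eq_add_of_le' hN
  have h := EinsteinRosen.isLittleO_truncatedSqDist hc hreg (by linarith) M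
  -- The rate `3/2` is the value of `(β + 1) / 2` at the smallest admissible `β = 2`.
  exact ⟨h, EinsteinRosen.isBigO_of_isLittleO_sub_rpow (by linarith) h⟩
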